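/- Let $1<p<\infty$, let $\mathcal N$ be a compact smooth manifold without boundary, smoothly (isometrically) embedded in $\mathbb R^\ell$, and let $\mathbb B^m$ denote the unit ball of $\mathbb R^m$. Let $W^{1,p}(\mathbb B^m,\mathcal N)$ be the set of $u\in W^{1,p}(\mathbb B^m,\mathbb R^\ell)$ with $u(x)\in\mathcal N$ for almost every $x$, and let $W^{1,p}_{\rm ct}(\mathbb B^m,\mathcal N)$ be the set of those $u\in W^{1,p}(\mathbb B^m,\mathcal N)$ whose trace on $\partial\mathbb B^m$ is constant, i.e. $u-c\in W^{1,p}_0(\mathbb B^m,\mathbb R^\ell)$ for some $c\in\mathcal N$. Say that $u\in W^{1,p}(\mathbb B^m,\mathcal N)$ is a weak limit of smooth maps if there is a sequence of maps in $C^\infty(\mathbb B^m,\mathcal N)$ (smooth up to the boundary) that converges to $u$ weakly in $W^{1,p}(\mathbb B^m,\mathbb R^\ell)$. Let $m_0\ge 1$ be an integer and suppose that there exists a map $u\in W^{1,p}_{\rm ct}(\mathbb B^{m_0},\mathcal N)$ which is not a weak limit of smooth maps. Then for every integer $m\ge m_0$ there exists a map $v\in W^{1,p}_{\rm ct}(\mathbb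 B^{m},\mathcal N)$ which is not a weak limit of smooth maps. -/

import Mathlib

open MeasureTheory Filter
open scoped ContDiff Manifold ENNReal Topology

/-- Euclidean space `ℝⁿ` with its Euclidean norm. -/
abbrev Euc (n : ℕ) : Type := EuclideanSpace ℝ (Fin n)

/-- Lebesgue measure on the unit ball `𝔹ᵐ` of `ℝᵐ`. -/
noncomputable abbrev ballMeasure (m : ℕ) : Measure (Euc m) :=
  (volume : Measure (Euc m)).restrict (Metric.ball (0 : Euc m) 1)

instance ballMeasure_isFiniteMeasure (m : ℕ) :
    IsFiniteMeasure ((volume : Measure (Euc m)).restrict (Metric.ball (0 : Euc m) 1)) :=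
  isFiniteMeasure_restrict.2 measure_ball_lt_top.ne

/-- `φ ∈ C_c^∞(𝔹ᵐ; E)`: `φ` is smooth on `ℝᵐ` with compact support inside the open unit ball. -/
def IsBallTest {m : ℕ} {E : Type*} [NormedAddCommGroup E] [NormedSpace ℝ E]
    (φ : Euc m → E) : Prop :=
  ContDiff ℝ ∞ φ ∧ HasCompactSupport φ ∧ tsupport φ ⊆ Metric.ball (0 : Euc m) 1

/-- `G` is the weak (distributional) derivative of `u` on the open unit ball:
`∫_𝔹 (∂_v φ) u = - ∫_𝔹 φ G(v)` for every real test function `φ` and every direction `v`. -/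
def IsWeakDerivOnBall {m ℓ : ℕ} (u : Euc m → Euc ℓ) (G : Euc m → Euc m →L[ℝ] Euc ℓ) : Prop :=
  ∀ φ : Euc m → ℝ, IsBallTest φ → ∀ v : Euc m,
    ∫ x, (fderiv ℝ φ x v) • u x ∂ballMeasure m = - ∫ x, φ x • G x v ∂ballMeasure m

theorem IsBallTest.integrable_fderiv_smul {m ℓ : ℕ} {φ : Euc m → ℝ} (hφ : IsBallTest φ)
    (v : Euc m) {u : Euc m → Euc ℓ} (hu : Integrable u (ballMeasure m)) :
    Integrable (fun x => (fderiv ℝ φ x v) • u x) (ballMeasure m) := by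
  have hc : Continuous fun x => fderiv ℝ φ x v :=
    (hφ.1.continuous_fderiv (by simp)).clm_apply continuous_const
  have hs : HasCompactSupport fun x => fderiv ℝ φ x v := hφ.2.1.fderiv_apply ℝ v
  obtain ⟨C, hC⟩ := hs.exists_bound_of_continuous hc
  exact hu.bdd_smul C hc.aestronglyMeasurable (Eventually.of_forall hC)

theorem IsBallTest.integrable_smul_apply {m ℓ : ℕ} {φ : Euc m → ℝ} (hφ : IsBallTest φ)
    (v : Euc m) {G : Euc m → Euc m →L[ℝ] Euc ℓ} (hG : Integrable G (ballMeasure m)) :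
    Integrable (fun x => φ x • G x v) (ballMeasure m) := by
  obtain ⟨C, hC⟩ := hφ.2.1.exists_bound_of_continuous hφ.1.continuous
  exact (hG.apply_continuousLinearMap v).bdd_smul C hφ.1.continuous.aestronglyMeasurable
    (Eventually.of_forall hC)

/-- The Sobolev space `W^{1,p}(𝔹ᵐ, ℝ^ℓ)`, as the normed space of all pairs `(u, Du)` in which
`u ∈ L^p` has the weak derivative `Du ∈ L^p`.  The pair is determined by `u`.  The norm is
`max ‖u‖_p ‖Du‖_p`, which is equivalent to `(‖u‖_p^p + ‖Du‖_p^p)^{1/p}`. -/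
noncomputable def W1p (m ℓ : ℕ) (p : ℝ≥0∞) [Fact (1 ≤ p)] :
    Submodule ℝ (Lp (Euc ℓ) p (ballMeasure m) × Lp (Euc m →L[ℝ] Euc ℓ) p (ballMeasure m)) where
  carrier := {w | IsWeakDerivOnBall (w.1 : Euc m → Euc ℓ) (w.2 : Euc m → Euc m →L[ℝ] Euc ℓ)}
  zero_mem' := by
    intro φ hφ v
    have h1 : ∫ x, (fderiv ℝ φ x v) • ((0 : Lp (Euc ℓ) p (ballMeasure m)) : Euc m → Euc ℓ) x
        ∂ballMeasure m = 0 := by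
      refine integral_eq_zero_of_ae ?_
      filter_upwards [Lp.coeFn_zero (Euc ℓ) p (ballMeasure m)] with x hx
      rw [hx, Pi.zero_apply, smul_zero]
    have h2 : ∫ x, φ x • ((0 : Lp (Euc m →L[ℝ] Euc ℓ) p (ballMeasure m)) :
        Euc m → Euc m →L[ℝ] Euc ℓ) x v ∂ballMeasure m = 0 := by
      refine integral_eq_zero_of_ae ?_
      filter_upwards [Lp.coeFn_zero (Euc m →L[ℝ] Euc ℓ) p (ballMeasure m)] with x hx
      rw [hx, Pi.zero_apply, Pi.zero_apply, zero_apply, smul_zero]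
    simp only [Prod.fst_zero, Prod.snd_zero]
    rw [h1, h2, neg_zero]
  add_mem' := by
    intro a b ha hb φ hφ v
    have ia := ((Lp.memLp a.1).integrable Fact.out)
    have ib := ((Lp.memLp b.1).integrable Fact.out)
    have ja := ((Lp.memLp a.2).integrable Fact.out)
    have jb := ((Lp.memLp b.2).integrable Fact.out)
    have h1 : ∫ x, (fderiv ℝ φ x v) • ((a + b).1 : Euc m → Euc ℓ) x ∂ballMeasure m
        = ∫ x, ((fderiv ℝ φ x v) • (a.1 : Euc m → Euc ℓ) x
            + (fderiv ℝ φ x v) • (b.1 : Euc m → Euc ℓ) x) ∂ballMeasure m := by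
      refine integral_congr_ae ?_
      filter_upwards [Lp.coeFn_add a.1 b.1] with x hx
      rw [Prod.fst_add, hx, Pi.add_apply, smul_add]
    have h2 : ∫ x, φ x • ((a + b).2 : Euc m → Euc m →L[ℝ] Euc ℓ) x v ∂ballMeasure m
        = ∫ x, (φ x • (a.2 : Euc m → Euc m →L[ℝ] Euc ℓ) x v
            + φ x • (b.2 : Euc m → Euc m →L[ℝ] Euc ℓ) x v) ∂ballMeasure m := by
      refine integral_congr_ae ?_
      filter_upwards [Lp.coeFn_add a.2 b.2] with x hx
      rw [Prod.snd_add, hx, Pi.add_apply, add_apply, smul_add]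
    rw [h1, h2, integral_add (hφ.integrable_fderiv_smul v ia) (hφ.integrable_fderiv_smul v ib),
      integral_add (hφ.integrable_smul_apply v ja) (hφ.integrable_smul_apply v jb),
      ha φ hφ v, hb φ hφ v, neg_add]
  smul_mem' := by
    intro c a ha φ hφ v
    have h1 : ∫ x, (fderiv ℝ φ x v) • ((c • a).1 : Euc m → Euc ℓ) x ∂ballMeasure m
        = ∫ x, c • ((fderiv ℝ φ x v) • (a.1 : Euc m → Euc ℓ) x) ∂ballMeasure m := by
      refine integral_congr_ae ?_
      filter_upwards [Lp.coeFn_smul c a.1] with x hx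
      rw [Prod.smul_fst, hx, Pi.smul_apply, smul_comm]
    have h2 : ∫ x, φ x • ((c • a).2 : Euc m → Euc m →L[ℝ] Euc ℓ) x v ∂ballMeasure m
        = ∫ x, c • (φ x • (a.2 : Euc m → Euc m →L[ℝ] Euc ℓ) x v) ∂ballMeasure m := by
      refine integral_congr_ae ?_
      filter_upwards [Lp.coeFn_smul c a.2] with x hx
      rw [Prod.smul_snd, hx, Pi.smul_apply, smul_apply, smul_comm]
    rw [h1, h2, integral_smul, integral_smul, ha φ hφ v, smul_neg]

/-- The (almost everywhere defined) map `𝔹ᵐ → ℝ^ℓ` underlying an element of `W^{1,p}`. -/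
noncomputable def reprFun {m ℓ : ℕ} {p : ℝ≥0∞} [Fact (1 ≤ p)] (u : W1p m ℓ p) :
    Euc m → Euc ℓ :=
  (u.1.1 : Euc m → Euc ℓ)

/-- `W^{1,p}_0(𝔹ᵐ, ℝ^ℓ)`, the closure of `C_c^∞(𝔹ᵐ; ℝ^ℓ)` in `W^{1,p}(𝔹ᵐ, ℝ^ℓ)`: the maps
with zero trace on the boundary sphere. -/
def W1pZero (m ℓ : ℕ) (p : ℝ≥0∞) [Fact (1 ≤ p)] : Set (W1p m ℓ p) :=
  closure {w | ∃ φ : Euc m → Euc ℓ, IsBallTest φ ∧ reprFun w =ᵐ[ballMeasure m] φ}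

/-- `W^{1,p}(𝔹ᵐ, N)` for `N ⊆ ℝ^ℓ`. -/
def W1pInto {ℓ : ℕ} (m : ℕ) (p : ℝ≥0∞) [Fact (1 ≤ p)] (N : Set (Euc ℓ)) : Set (W1p m ℓ p) :=
  {u | ∀ᵐ x ∂ballMeasure m, reprFun u x ∈ N}

/-- `W^{1,p}_ct(𝔹ᵐ, N)`: the maps in `W^{1,p}(𝔹ᵐ, N)` whose trace on the boundary sphere is
constant, equal to some `c ∈ N`. -/
def W1pConst {ℓ : ℕ} (m : ℕ) (p : ℝ≥0∞) [Fact (1 ≤ p)] (N : Set (Euc ℓ)) : Set (W1p m ℓ p) :=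
  {u | u ∈ W1pInto m p N ∧ ∃ c ∈ N, ∃ w ∈ W1pZero m ℓ p,
    reprFun u =ᵐ[ballMeasure m] fun x => c + reprFun w x}

/-- `C^∞(𝔹ᵐ, N)`, as a subset of `W^{1,p}(𝔹ᵐ, ℝ^ℓ)`: the maps that are smooth on the closed ball
(up to the boundary) and take their values in `N`. -/
def SmoothInto {ℓ : ℕ} (m : ℕ) (p : ℝ≥0∞) [Fact (1 ≤ p)] (N : Set (Euc ℓ)) : Set (W1p m ℓ p) :=
  {w | ∃ g : Euc m → Euc ℓ, ContDiffOn ℝ ∞ g (Metric.closedBall 0 1) ∧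
    (∀ x ∈ Metric.closedBall (0 : Euc m) 1, g x ∈ N) ∧ reprFun w =ᵐ[ballMeasure m] g}

/-- `u` is the limit, for the weak topology of the normed space `W^{1,p}(𝔹ᵐ, ℝ^ℓ)`, of a sequence
of maps in `C^∞(𝔹ᵐ, N)`. -/
def IsWeakLimitOfSmooth {m ℓ : ℕ} {p : ℝ≥0∞} [Fact (1 ≤ p)] (N : Set (Euc ℓ))
    (u : W1p m ℓ p) : Prop :=
  ∃ w : ℕ → W1p m ℓ p, (∀ n, w n ∈ SmoothInto m p N) ∧
    Tendsto (fun n => toWeakSpace ℝ (W1p m ℓ p) (w n)) atTop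
      (𝓝 (toWeakSpace ℝ (W1p m ℓ p) u))

section WeightedComposition

variable {α β F F' : Type*} [MeasurableSpace α] [MeasurableSpace β]
  [NormedAddCommGroup F] [NormedSpace ℝ F] [NormedAddCommGroup F'] [NormedSpace ℝ F']

/-- The data of a bounded weighted composition operator `f ↦ (y ↦ A y (f (κ y)))` from `L^p(ν)`
to `L^p(μ)`: the weight `A` is bounded and vanishes off `S`, and `κ` transports `μ` restricted to
`S` to a measure bounded by a multiple of `ν`. -/
structure IsWeightedComp (μ : Measure α) (ν : Measure β) (κ : α → β) (S : Set α)
    (A : α → F →L[ℝ] F') (c M : NNReal) : Prop where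
  measurable : Measurable κ
  measurableSet : MeasurableSet S
  map_le : (μ.restrict S).map κ ≤ c • ν
  weight : AEStronglyMeasurable A μ
  bound : ∀ y, ‖A y‖ ≤ M
  zero : ∀ y ∉ S, A y = 0

variable {μ : Measure α} {ν : Measure β} {κ : α → β} {S : Set α}
  {A : α → F →L[ℝ] F'} {c M : NNReal} {p : ℝ≥0∞}

theorem ae_restrict_comp_of_map_le (hκ : Measurable κ) (hmap : (μ.restrict S).map κ ≤ c • ν)
    {P : β → Prop} (h : ∀ᵐ x ∂ν, P x) : ∀ᵐ y ∂μ.restrict S, P (κ y) := by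
  refine ae_of_ae_map hκ.aemeasurable ?_
  have h1 : ∀ᵐ x ∂(c • ν), P x := Measure.ae_smul_measure h c
  exact (Measure.absolutelyContinuous_of_le hmap).ae_le h1

namespace IsWeightedComp

theorem eLpNorm_comp_le (H : IsWeightedComp μ ν κ S A c M) {f : β → F} (hp : p ≠ ⊤)
    (hf : AEStronglyMeasurable f ν) :
    eLpNorm (f ∘ κ) p (μ.restrict S) ≤ (c : ℝ≥0∞) ^ (1 / p.toReal) * eLpNorm f p ν := by
  have hac : AEStronglyMeasurable f ((μ.restrict S).map κ) :=
    (hf.smul_measure c).mono_measure H.map_le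
  rw [← eLpNorm_map_measure hac H.measurable.aemeasurable]
  refine (eLpNorm_mono_measure f H.map_le).trans ?_
  have := eLpNorm_smul_measure_of_ne_top (μ := ν) hp f (c : ℝ≥0∞)
  rw [smul_eq_mul] at this
  rw [show (c • ν) = ((c : ℝ≥0∞) • ν) from rfl, this]
  simp

theorem eq_indicator (H : IsWeightedComp μ ν κ S A c M) (f : β → F) :
    (fun y => A y (f (κ y))) = S.indicator fun y => A y (f (κ y)) := by
  ext1 y
  by_cases hy : y ∈ S
  · rw [Set.indicator_of_mem hy]
  · rw [Set.indicator_of_notMem hy, H.zero y hy, zero_apply]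

theorem aestronglyMeasurable (H : IsWeightedComp μ ν κ S A c M) {f : β → F}
    (hf : AEStronglyMeasurable f ν) : AEStronglyMeasurable (fun y => A y (f (κ y))) μ := by
  rw [H.eq_indicator f, aestronglyMeasurable_indicator_iff H.measurableSet]
  have hac : AEStronglyMeasurable f ((μ.restrict S).map κ) :=
    (hf.smul_measure c).mono_measure H.map_le
  have h1 : AEStronglyMeasurable (f ∘ κ) (μ.restrict S) := hac.comp_measurable H.measurable
  exact (ContinuousLinearMap.apply ℝ F').flip.aestronglyMeasurable_comp₂ H.weight.restrict h1

theorem eLpNorm_le (H : IsWeightedComp μ ν κ S A c M) (hp : p ≠ ⊤) {f : β → F}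
    (hf : AEStronglyMeasurable f ν) :
    eLpNorm (fun y => A y (f (κ y))) p μ
      ≤ M * ((c : ℝ≥0∞) ^ (1 / p.toReal) * eLpNorm f p ν) := by
  rw [H.eq_indicator f, eLpNorm_indicator_eq_eLpNorm_restrict H.measurableSet]
  refine le_trans ?_ (mul_le_mul_right (H.eLpNorm_comp_le hp hf) _)
  have := eLpNorm_le_nnreal_smul_eLpNorm_of_ae_le_mul (μ := μ.restrict S) (c := M)
    (f := fun y => A y (f (κ y))) (g := f ∘ κ) (ae_of_all _ fun y => by
      have := (A y).le_opNorm (f (κ y))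
      exact_mod_cast this.trans (mul_le_mul_of_nonneg_right (H.bound y) (norm_nonneg _))) p
  simpa [ENNReal.smul_def] using this

theorem memLp (H : IsWeightedComp μ ν κ S A c M) (hp : p ≠ ⊤) {f : β → F}
    (hf : MemLp f p ν) : MemLp (fun y => A y (f (κ y))) p μ := by
  refine ⟨H.aestronglyMeasurable hf.1, (H.eLpNorm_le hp hf.1).trans_lt ?_⟩
  refine ENNReal.mul_lt_top ENNReal.coe_lt_top (ENNReal.mul_lt_top ?_ hf.2)
  exact ENNReal.rpow_lt_top_of_nonneg (by positivity) ENNReal.coe_ne_top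

theorem congr_ae (H : IsWeightedComp μ ν κ S A c M) {f g : β → F} (h : f =ᵐ[ν] g) :
    (fun y => A y (f (κ y))) =ᵐ[μ] fun y => A y (g (κ y)) := by
  have h1 := ae_restrict_comp_of_map_le H.measurable H.map_le h
  rw [ae_restrict_iff' H.measurableSet] at h1
  filter_upwards [h1] with y hy
  by_cases hyS : y ∈ S
  · rw [hy hyS]
  · rw [H.zero y hyS, zero_apply, zero_apply]

/-- The operator `f ↦ (y ↦ A y (f (κ y)))` from `L^p(ν)` to `L^p(μ)`. -/
noncomputable def toCLM [Fact (1 ≤ p)] (H : IsWeightedComp μ ν κ S A c M) (hp : p ≠ ⊤) :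
    Lp F p ν →L[ℝ] Lp F' p μ :=
  LinearMap.mkContinuous
    { toFun := fun f => (H.memLp hp (Lp.memLp f)).toLp
      map_add' := fun f g => by
        rw [← MemLp.toLp_add, MemLp.toLp_eq_toLp_iff]
        filter_upwards [H.congr_ae (Lp.coeFn_add f g)] with y hy
        rw [hy]; simp
      map_smul' := fun r f => by
        rw [RingHom.id_apply, ← MemLp.toLp_const_smul, MemLp.toLp_eq_toLp_iff]
        filter_upwards [H.congr_ae (Lp.coeFn_smul r f)] with y hy
        rw [hy]; simp }
    (M * (((c : ℝ≥0∞) ^ (1 / p.toReal)).toReal)) (fun f => by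
      simp only [LinearMap.coe_mk, AddHom.coe_mk]
      rw [Lp.norm_toLp, Lp.norm_def, mul_assoc]
      have := ENNReal.toReal_mono ?_ (H.eLpNorm_le hp (Lp.memLp f).1)
      · simpa using this
      refine (ENNReal.mul_lt_top ENNReal.coe_lt_top (ENNReal.mul_lt_top ?_ (Lp.memLp f).2)).ne
      exact ENNReal.rpow_lt_top_of_nonneg (by positivity) ENNReal.coe_ne_top)

theorem coeFn_toCLM [Fact (1 ≤ p)] (H : IsWeightedComp μ ν κ S A c M) (hp : p ≠ ⊤)
    (f : Lp F p ν) : H.toCLM hp f =ᵐ[μ] fun y => A y (f (κ y)) :=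
  (H.memLp hp (Lp.memLp f)).coeFn_toLp

end IsWeightedComp

/-- Multiplication by the indicator function of a measurable set. -/
theorem isWeightedComp_indicator (μ : Measure α) {E : Set α} (hE : MeasurableSet E) :
    IsWeightedComp μ μ id Set.univ
      (fun x => E.indicator (fun _ => ContinuousLinearMap.id ℝ F) x) 1 1 where
  measurable := measurable_id
  measurableSet := MeasurableSet.univ
  map_le := by simp
  weight := (aestronglyMeasurable_const.indicator hE)
  bound := fun y => by
    refine (norm_indicator_le_norm_self _ _).trans ?_
    exact ContinuousLinearMap.norm_id_le
  zero := fun y hy => absurd (Set.mem_univ y) hy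

end WeightedComposition

section LpDual

variable {α : Type*} [MeasurableSpace α] {μ : Measure α} [IsFiniteMeasure μ] {p q : ℝ≥0∞}

theorem sum_indicatorConstLp_eq_biUnion {f : ℕ → Set α}
    (hf : ∀ i, MeasurableSet (f i)) (hd : Pairwise (Function.onFun Disjoint f)) (s : Finset ℕ) :
    ∑ i ∈ s, indicatorConstLp p (hf i) (measure_ne_top μ _) (1 : ℝ)
      = indicatorConstLp p (s.measurableSet_biUnion fun i _ => hf i)
        (measure_ne_top μ _) (1 : ℝ) := by
  classical
  induction s using Finset.induction_on with
  | empty =>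
    ext1
    filter_upwards [Lp.coeFn_zero ℝ p μ, indicatorConstLp_coeFn (p := p) (μ := μ)
      (hs := (∅ : Finset ℕ).measurableSet_biUnion fun i _ => hf i)
      (hμs := measure_ne_top μ _) (c := (1 : ℝ))] with x h1 h2
    rw [Finset.sum_empty, h1, h2]; simp
  | insert a s ha ih =>
    rw [Finset.sum_insert ha, ih, ← indicatorConstLp_disjoint_union]
    · congr 1
      rw [Finset.set_biUnion_insert]
    · rw [Set.disjoint_iUnion₂_right]
      intro i hi
      exact hd fun h => ha (h ▸ hi)

theorem hasSum_indicatorConstLp_iUnion [Fact (1 ≤ p)] (hp : p ≠ ⊤) {f : ℕ → Set α}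
    (hf : ∀ i, MeasurableSet (f i)) (hd : Pairwise (Function.onFun Disjoint f)) :
    HasSum (fun i => indicatorConstLp p (hf i) (measure_ne_top μ _) (1 : ℝ))
      (indicatorConstLp p (MeasurableSet.iUnion hf) (measure_ne_top μ _) (1 : ℝ)) := by
  unfold HasSum
  simp_rw [sum_indicatorConstLp_eq_biUnion hf hd]
  refine tendsto_indicatorConstLp_set hp ?_
  have hsub : ∀ s : Finset ℕ, (⋃ i ∈ s, f i) ⊆ ⋃ i, f i :=
    fun n => Set.iUnion₂_subset fun i _ => Set.subset_iUnion f i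
  have h1 : HasSum (fun i => μ (f i)) (μ (⋃ i, f i)) := by
    rw [measure_iUnion hd hf]; exact ENNReal.summable.hasSum
  have h2 := ENNReal.Tendsto.sub (tendsto_const_nhds (x := μ (⋃ i, f i)) (f := atTop)) h1
    (Or.inl (measure_ne_top μ _))
  rw [tsub_self] at h2
  refine h2.congr fun s => ?_
  rw [Set.symmDiff_def, Set.sdiff_eq_empty.2 (hsub s), Set.empty_union,
    measure_sdiff (hsub s) (s.measurableSet_biUnion fun i _ => hf i).nullMeasurableSet
      (measure_ne_top μ _), measure_biUnion_finset (fun i _ j _ h => hd h) (fun i _ => hf i)]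

open Classical in
/-- The signed measure `E ↦ L(1_E)` of a continuous functional `L` on `L^p`. -/
noncomputable def dualSignedMeasure [Fact (1 ≤ p)] (hp : p ≠ ⊤) (L : Lp ℝ p μ →L[ℝ] ℝ) :
    SignedMeasure α where
  measureOf' := fun E => if hE : MeasurableSet E then
      L (indicatorConstLp p hE (measure_ne_top μ _) (1 : ℝ)) else 0
  empty' := by simp
  not_measurable' := fun E hE => by simp [hE]
  m_iUnion' := fun f hf hd => by
    simp only [hf, MeasurableSet.iUnion hf, dif_pos]
    exact L.hasSum (hasSum_indicatorConstLp_iUnion hp hf hd)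

theorem dualSignedMeasure_apply [Fact (1 ≤ p)] (hp : p ≠ ⊤) (L : Lp ℝ p μ →L[ℝ] ℝ)
    {E : Set α} (hE : MeasurableSet E) :
    dualSignedMeasure hp L E = L (indicatorConstLp p hE (measure_ne_top μ _) (1 : ℝ)) :=
  dif_pos hE

theorem exists_density_of_dual [Fact (1 ≤ p)] (hp : p ≠ ⊤) (L : Lp ℝ p μ →L[ℝ] ℝ) :
    ∃ h : α → ℝ, Measurable h ∧ Integrable h μ ∧ ∀ (E : Set α) (hE : MeasurableSet E),
      L (indicatorConstLp p hE (measure_ne_top μ _) (1 : ℝ)) = ∫ x in E, h x ∂μ := by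
  refine ⟨(dualSignedMeasure hp L).rnDeriv μ, SignedMeasure.measurable_rnDeriv _ _,
    SignedMeasure.integrable_rnDeriv _ _, fun E hE => ?_⟩
  have hac : dualSignedMeasure hp L ≪ᵥ μ.toENNRealVectorMeasure := by
    refine VectorMeasure.AbsolutelyContinuous.mk fun E hE h0 => ?_
    rw [Measure.toENNRealVectorMeasure_apply_measurable hE] at h0
    rw [dualSignedMeasure_apply hp L hE]
    have : indicatorConstLp p hE (measure_ne_top μ _) (1 : ℝ) = 0 := by
      ext1
      filter_upwards [indicatorConstLp_coeFn (p := p) (hs := hE) (hμs := measure_ne_top μ E)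
        (c := (1 : ℝ)), Lp.coeFn_zero ℝ p μ, measure_eq_zero_iff_ae_notMem.1 h0] with x h1 h2 h3
      rw [h1, h2, Set.indicator_of_notMem h3]; rfl
    rw [this, map_zero]
  rw [← dualSignedMeasure_apply hp L hE,
    ← withDensityᵥ_apply (SignedMeasure.integrable_rnDeriv _ _) hE,
    SignedMeasure.withDensityᵥ_rnDeriv_eq _ _ hac]

/-- A functional on `L^p` that is given on indicator functions by a bounded density is given by
that density. -/
theorem dual_eq_integral_of_bounded [Fact (1 ≤ p)] [ENNReal.HolderConjugate q p] (hp : p ≠ ⊤)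
    (L : Lp ℝ p μ →L[ℝ] ℝ) {h : α → ℝ} (hh : MemLp h q μ)
    (hL : ∀ (E : Set α) (hE : MeasurableSet E),
      L (indicatorConstLp p hE (measure_ne_top μ _) (1 : ℝ)) = ∫ x in E, h x ∂μ)
    (f : Lp ℝ p μ) : L f = ∫ x, h x * f x ∂μ := by
  have : Fact (1 ≤ q) := ⟨ENNReal.HolderConjugate.one_le q p⟩
  set B := (ContinuousLinearMap.mul ℝ ℝ).lpPairing μ q p hh.toLp with hB
  have hBf : ∀ f : Lp ℝ p μ, B f = ∫ x, h x * f x ∂μ := by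
    intro f
    rw [hB, ContinuousLinearMap.lpPairing_eq_integral]
    refine integral_congr_ae ?_
    filter_upwards [hh.coeFn_toLp] with x hx
    simp [hx]
  rw [← hBf]
  refine Lp.induction hp (motive := fun f => L f = B f) ?_ ?_ ?_ f
  · intro c E hE hμE
    have h1 : ((Lp.simpleFunc.indicatorConst p hE hμE.ne c : Lp.simpleFunc ℝ p μ) : Lp ℝ p μ)
        = c • indicatorConstLp p hE (measure_ne_top μ _) (1 : ℝ) := by
      rw [Lp.simpleFunc.coe_indicatorConst]
      ext1
      filter_upwards [indicatorConstLp_coeFn (p := p) (hs := hE) (hμs := measure_ne_top μ E)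
        (c := c), Lp.coeFn_smul c (indicatorConstLp p hE (measure_ne_top μ _) (1 : ℝ)),
        indicatorConstLp_coeFn (p := p) (hs := hE) (hμs := measure_ne_top μ E)
        (c := (1 : ℝ))] with x h1 h2 h3
      rw [h1, h2, Pi.smul_apply, h3]
      by_cases hx : x ∈ E <;> simp [hx]
    rw [h1, map_smul, map_smul, hL E hE, hBf, ← integral_indicator hE]
    congr 1
    refine integral_congr_ae ?_
    filter_upwards [indicatorConstLp_coeFn (p := p) (hs := hE) (hμs := measure_ne_top μ E)
        (c := (1 : ℝ))] with x h3
    rw [h3]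
    by_cases hx : x ∈ E <;> simp [hx]
  · intro f g hf hg _ h1 h2
    rw [map_add, map_add, h1, h2]
  · exact isClosed_eq L.continuous B.continuous

end LpDual

section LpDual

variable {α : Type*} [MeasurableSpace α] {μ : Measure α} [IsFiniteMeasure μ] {p q : ℝ≥0∞}

theorem eLpNorm_le_opNorm_of_bounded_density [Fact (1 ≤ p)] [ENNReal.HolderConjugate q p]
    (hp1 : 1 < p) (hp : p ≠ ⊤)
    (L : Lp ℝ p μ →L[ℝ] ℝ) {h : α → ℝ} (hm : Measurable h) {C : ℝ} (hb : ∀ x, |h x| ≤ C)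
    (hL : ∀ f : Lp ℝ p μ, L f = ∫ x, h x * f x ∂μ) :
    eLpNorm h q μ ≤ ENNReal.ofReal ‖L‖ := by
  have hc : Real.HolderConjugate q.toReal p.toReal := by
    have hq1 : 1 < q := (ENNReal.HolderConjugate.lt_top_iff_one_lt p q).1 hp.lt_top
    have hqt : q < ⊤ := (ENNReal.HolderConjugate.lt_top_iff_one_lt q p).2 hp1
    exact ENNReal.HolderConjugate.toReal_of_ne_top hqt.ne hp
  have hqt : q ≠ ⊤ := ((ENNReal.HolderConjugate.lt_top_iff_one_lt q p).2 hp1).ne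
  set P := p.toReal
  set Q := q.toReal
  have hQ0 : 0 < Q := hc.pos
  have hP0 : 0 < P := hc.symm.pos
  have hC : 0 ≤ max C 0 := le_max_right _ _
  have hq0 : q ≠ 0 := (ENNReal.toReal_pos_iff.1 hQ0).1.ne'
  have hp0 : p ≠ 0 := (zero_lt_one.trans hp1).ne'
  have hh : MemLp h q μ := MemLp.of_bound hm.aestronglyMeasurable C (ae_of_all _ hb)
  set f : α → ℝ := fun x => SignType.sign (h x) * |h x| ^ (Q - 1) with hf
  have hfm : Measurable f := by
    refine Measurable.mul ?_ ((hm.abs).pow_const _)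
    have : (fun x => ((SignType.sign (h x) : SignType) : ℝ))
        = fun x => if 0 < h x then 1 else if h x < 0 then (-1 : ℝ) else 0 := by
      ext x; rw [sign_apply]; split_ifs <;> simp
    rw [this]
    exact Measurable.ite (measurableSet_lt measurable_const hm) measurable_const
      (Measurable.ite (measurableSet_lt hm measurable_const) measurable_const measurable_const)
  have hQ1 : 0 < Q - 1 := hc.sub_one_pos
  have hfabs : ∀ x, |f x| = |h x| ^ (Q - 1) := by
    intro x
    rw [hf]
    simp only [abs_mul]
    rcases eq_or_ne (h x) 0 with h0 | h0
    · rw [h0, abs_zero, Real.zero_rpow hQ1.ne']; simp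
    · have : |((SignType.sign (h x) : SignType) : ℝ)| = 1 := by
        rcases h0.lt_or_gt with h1 | h1
        · rw [sign_neg h1]; simp
        · rw [sign_pos h1]; simp
      rw [this, one_mul, abs_of_nonneg (by positivity)]
  have hfh : ∀ x, h x * f x = |h x| ^ Q := by
    intro x
    rw [hf]
    simp only
    rw [← mul_assoc, mul_comm (h x), sign_mul_self]
    rcases eq_or_ne (h x) 0 with h0 | h0
    · rw [h0, abs_zero, Real.zero_rpow hQ0.ne', zero_mul]
    · conv_lhs => rw [← Real.rpow_one |h x|, Real.rpow_one]
      rw [← Real.rpow_one_add' (abs_nonneg _) (by linarith)]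
      congr 1; ring
  have hfp : ∀ x, ‖f x‖ ^ P = |h x| ^ Q := by
    intro x
    rw [Real.norm_eq_abs, hfabs, ← Real.rpow_mul (abs_nonneg _)]
    congr 1
    exact hc.sub_one_mul_conj
  have hfL : MemLp f p μ := by
    refine MemLp.of_bound hfm.aestronglyMeasurable ((max C 0) ^ (Q - 1)) (ae_of_all _ fun x => ?_)
    rw [Real.norm_eq_abs, hfabs]
    exact Real.rpow_le_rpow (abs_nonneg _) ((hb x).trans (le_max_left _ _)) hQ1.le
  set X := ∫ x, |h x| ^ Q ∂μ with hX
  have hX0 : 0 ≤ X := integral_nonneg fun x => by positivity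
  have h1 : L hfL.toLp = X := by
    rw [hL]
    refine integral_congr_ae ?_
    filter_upwards [hfL.coeFn_toLp] with x hx
    rw [hx, hfh]
  have h2 : ‖hfL.toLp‖ = X ^ P⁻¹ := by
    rw [Lp.norm_toLp, hfL.eLpNorm_eq_integral_rpow_norm hp0 hp,
      ENNReal.toReal_ofReal (Real.rpow_nonneg (integral_nonneg fun x => by positivity) _)]
    congr 1
    exact integral_congr_ae (ae_of_all _ hfp)
  have h3 : X ≤ ‖L‖ * X ^ P⁻¹ := by
    rw [← h2, ← h1]; exact (le_abs_self _).trans (L.le_opNorm _)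
  rw [hh.eLpNorm_eq_integral_rpow_norm hq0 hqt]
  refine ENNReal.ofReal_le_ofReal ?_
  simp_rw [Real.norm_eq_abs]
  change X ^ Q⁻¹ ≤ ‖L‖
  rcases hX0.eq_or_lt with h0 | h0
  · rw [← h0, Real.zero_rpow (by positivity)]; exact norm_nonneg _
  · have h4 : X = X ^ Q⁻¹ * X ^ P⁻¹ := by
      rw [← Real.rpow_add h0, hc.inv_add_inv_eq_one, Real.rpow_one]
    have h5 : 0 < X ^ P⁻¹ := Real.rpow_pos_of_pos h0 _
    exact le_of_mul_le_mul_right (h4 ▸ h3 : X ^ Q⁻¹ * X ^ P⁻¹ ≤ ‖L‖ * X ^ P⁻¹) h5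

/-- Riesz representation: every continuous functional on `L^p`, `1 < p < ∞`, over a finite measure
is integration against an `L^q` function. -/
theorem exists_memLp_of_dual [Fact (1 ≤ p)] [ENNReal.HolderConjugate q p]
    (hp1 : 1 < p) (hp : p ≠ ⊤) (L : Lp ℝ p μ →L[ℝ] ℝ) :
    ∃ h : α → ℝ, MemLp h q μ ∧ ∀ f : Lp ℝ p μ, L f = ∫ x, h x * f x ∂μ := by
  obtain ⟨h, hm, hi, hL⟩ := exists_density_of_dual hp L
  suffices hq : MemLp h q μ from
    ⟨h, hq, dual_eq_integral_of_bounded (q := q) hp L hq hL⟩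
  set E : ℕ → Set α := fun k => {x | |h x| ≤ k} with hE
  have hEm : ∀ k, MeasurableSet (E k) := fun k => measurableSet_le hm.abs measurable_const
  have hb : ∀ k x, |(E k).indicator h x| ≤ k := by
    intro k x
    by_cases hx : x ∈ E k
    · rw [Set.indicator_of_mem hx]; exact hx
    · rw [Set.indicator_of_notMem hx]; simp
  have hm' : ∀ k, Measurable ((E k).indicator h) := fun k => hm.indicator (hEm k)
  have key : ∀ k, eLpNorm ((E k).indicator h) q μ ≤ ENNReal.ofReal ‖L‖ := by
    intro k
    set χ := (isWeightedComp_indicator (F := ℝ) μ (hEm k)).toCLM hp with hχ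
    have hχf := (isWeightedComp_indicator (F := ℝ) μ (hEm k)).coeFn_toCLM hp
    refine (eLpNorm_le_opNorm_of_bounded_density hp1 hp (L.comp χ) (hm' k) (hb k) ?_).trans ?_
    · refine dual_eq_integral_of_bounded (q := q) hp (L.comp χ)
        (MemLp.of_bound (hm' k).aestronglyMeasurable k (ae_of_all _ (hb k))) fun A hA => ?_
      rw [setIntegral_indicator (hEm k), ← hL _ (hA.inter (hEm k)), ContinuousLinearMap.comp_apply]
      congr 1
      ext1
      filter_upwards [hχf (indicatorConstLp p hA (measure_ne_top μ _) (1 : ℝ)),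
        indicatorConstLp_coeFn (p := p) (hs := hA) (hμs := measure_ne_top μ A) (c := (1 : ℝ)),
        indicatorConstLp_coeFn (p := p) (hs := hA.inter (hEm k))
          (hμs := measure_ne_top μ _) (c := (1 : ℝ))] with x h1 h2 h3
      rw [h1, h3, id, h2]
      by_cases hxA : x ∈ A <;> by_cases hxE : x ∈ E k <;> simp [hxA, hxE]
    · refine ENNReal.ofReal_le_ofReal ?_
      refine (L.opNorm_comp_le χ).trans ?_
      have : ‖χ‖ ≤ 1 := by
        refine (LinearMap.mkContinuous_norm_le _ (by positivity) _).trans ?_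
        simp
      nlinarith [norm_nonneg L]
  refine ⟨hm.aestronglyMeasurable, lt_of_le_of_lt ?_ (ENNReal.ofReal_lt_top (r := ‖L‖))⟩
  refine Lp.eLpNorm_le_of_ae_tendsto (u := atTop) (Eventually.of_forall key)
    (fun k => (hm' k).aestronglyMeasurable) (ae_of_all _ fun x => ?_)
  refine tendsto_const_nhds.congr' ?_
  obtain ⟨n, hn⟩ := exists_nat_ge |h x|
  filter_upwards [eventually_ge_atTop n] with k hk
  rw [Set.indicator_of_mem]
  exact hn.trans (by exact_mod_cast hk)

end LpDual

section WeakConvergence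

variable {m : ℕ} {p q : ℝ≥0∞}

theorem IsBallTest.memLp {E : Type*} [NormedAddCommGroup E] [NormedSpace ℝ E] {η : Euc m → E}
    (hη : IsBallTest η) : MemLp η q (ballMeasure m) :=
  hη.1.continuous.memLp_of_hasCompactSupport hη.2.1

/-- The test functions, as a subspace of `L^q` of the ball. -/
def testSubmodule (m : ℕ) (q : ℝ≥0∞) : Submodule ℝ (Lp ℝ q (ballMeasure m)) where
  carrier := {g | ∃ η : Euc m → ℝ, IsBallTest η ∧ g =ᵐ[ballMeasure m] η}
  zero_mem' := ⟨fun _ => 0, ⟨contDiff_const, HasCompactSupport.zero, by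
    rw [show (fun _ : Euc m => (0 : ℝ)) = 0 from rfl, tsupport, Function.support_zero]; simp⟩,
    Lp.coeFn_zero _ _ _⟩
  add_mem' := by
    rintro a b ⟨η, hη, ha⟩ ⟨ζ, hζ, hb⟩
    refine ⟨η + ζ, ⟨hη.1.add hζ.1, hη.2.1.add hζ.2.1, ?_⟩, ?_⟩
    · exact (tsupport_add η ζ).trans (Set.union_subset hη.2.2 hζ.2.2)
    · filter_upwards [Lp.coeFn_add a b, ha, hb] with x h1 h2 h3
      rw [h1, Pi.add_apply, h2, h3, Pi.add_apply]
  smul_mem' := by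
    rintro c a ⟨η, hη, ha⟩
    refine ⟨fun x => c • η x, ⟨hη.1.const_smul c, hη.2.1.smul_left (f := fun _ => c), ?_⟩, ?_⟩
    · exact (tsupport_smul_subset_right (fun _ => c) η).trans hη.2.2
    · filter_upwards [Lp.coeFn_smul c a, ha] with x h1 h2
      rw [h1, Pi.smul_apply, h2]

theorem ae_eq_zero_of_integral_test_eq_zero {F : Type*} [NormedAddCommGroup F] [NormedSpace ℝ F]
    [CompleteSpace F] {f : Euc m → F} (hf : Integrable f (ballMeasure m))
    (h : ∀ η : Euc m → ℝ, IsBallTest η → ∫ x, η x • f x ∂ballMeasure m = 0) :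
    f =ᵐ[ballMeasure m] 0 := by
  have h1 := Metric.isOpen_ball.ae_eq_zero_of_integral_contDiff_smul_eq_zero
    (E := Euc m) (μ := volume) (U := Metric.ball (0 : Euc m) 1) (f := f)
    (IntegrableOn.locallyIntegrableOn hf) (fun η h1 h2 h3 => ?_)
  · exact (ae_restrict_iff' measurableSet_ball).2 h1
  · have h4 := h η ⟨h1, h2, h3⟩
    rwa [setIntegral_eq_integral_of_forall_compl_eq_zero] at h4
    intro x hx
    rw [image_eq_zero_of_notMem_tsupport (fun hx' => hx (h3 hx')), zero_smul]

theorem testSubmodule_topologicalClosure [Fact (1 ≤ q)] [ENNReal.HolderConjugate p q]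
    (hq1 : 1 < q) (hq : q ≠ ⊤) :
    closure (testSubmodule m q : Set (Lp ℝ q (ballMeasure m))) = Set.univ := by
  rw [Set.eq_univ_iff_forall]
  intro g
  by_contra hg
  obtain ⟨L, u, hu1, hu2⟩ := geometric_hahn_banach_point_closed
    (testSubmodule m q).convex.closure isClosed_closure hg
  have hL0 : ∀ a ∈ testSubmodule m q, L a = 0 := by
    intro a ha
    by_contra hne
    have h1 := hu2 (((u - 1) / L a) • a) (subset_closure ((testSubmodule m q).smul_mem _ ha))
    rw [map_smul, smul_eq_mul, div_mul_cancel₀ _ hne] at h1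
    linarith
  obtain ⟨h, hh, hL⟩ := exists_memLp_of_dual (q := p) hq1 hq L
  have hp1 : 1 ≤ p := ENNReal.HolderConjugate.one_le p q
  have h0 : h =ᵐ[ballMeasure m] 0 := by
    refine ae_eq_zero_of_integral_test_eq_zero (hh.integrable hp1) fun η hη => ?_
    have h1 := hL0 hη.memLp.toLp ⟨η, hη, hη.memLp.coeFn_toLp⟩
    rw [hL] at h1
    rw [← h1]
    refine integral_congr_ae ?_
    filter_upwards [(hη.memLp (q := q)).coeFn_toLp] with x hx
    rw [hx, smul_eq_mul, mul_comm]
  have h2 : ∀ f, L f = 0 := by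
    intro f
    rw [hL]
    refine integral_eq_zero_of_ae ?_
    filter_upwards [h0] with x hx
    rw [hx]; simp
  have h3 := hu2 0 (subset_closure (testSubmodule m q).zero_mem)
  rw [h2] at hu1 h3
  linarith

/-- A bounded sequence in `L^p`, `1 < p < ∞`, that converges against all test functions converges
weakly (scalar case). -/
theorem tendsto_dual_of_tendsto_test_real [Fact (1 ≤ p)] (hp1 : 1 < p) (hp : p ≠ ⊤)
    {f : ℕ → Lp ℝ p (ballMeasure m)} {g : Lp ℝ p (ballMeasure m)} {K : ℝ} (hK : ∀ n, ‖f n‖ ≤ K)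
    (h : ∀ η : Euc m → ℝ, IsBallTest η →
      Tendsto (fun n => ∫ x, η x * f n x ∂ballMeasure m) atTop
        (𝓝 (∫ x, η x * g x ∂ballMeasure m)))
    (L : Lp ℝ p (ballMeasure m) →L[ℝ] ℝ) : Tendsto (fun n => L (f n)) atTop (𝓝 (L g)) := by
  have : ENNReal.HolderConjugate p p.conjExponent := ENNReal.HolderConjugate.conjExponent hp1.le
  set q := p.conjExponent
  have hq1 : 1 < q := (ENNReal.HolderConjugate.lt_top_iff_one_lt p q).1 hp.lt_top
  have hqt : q < ⊤ := (ENNReal.HolderConjugate.lt_top_iff_one_lt q p).2 hp1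
  have : Fact (1 ≤ q) := ⟨hq1.le⟩
  obtain ⟨k, hk, hL⟩ := exists_memLp_of_dual (q := q) hp1 hp L
  set B := (ContinuousLinearMap.mul ℝ ℝ).lpPairing (ballMeasure m) q p with hB
  have hBe : ∀ (a : Lp ℝ q (ballMeasure m)) (b : Lp ℝ p (ballMeasure m)),
      B a b = ∫ x, a x * b x ∂ballMeasure m := fun a b => by
    rw [hB, ContinuousLinearMap.lpPairing_eq_integral]; rfl
  have hLB : ∀ b, L b = B hk.toLp b := by
    intro b
    rw [hL, hBe]
    refine integral_congr_ae ?_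
    filter_upwards [hk.coeFn_toLp] with x hx
    rw [hx]
  rw [Metric.tendsto_atTop]
  intro ε hε
  set R := ‖B‖ * (|K| + ‖g‖) + 1 with hR
  have hR0 : 0 < R := by positivity
  have hcl : hk.toLp ∈ closure (testSubmodule m q : Set (Lp ℝ q (ballMeasure m))) := by
    rw [testSubmodule_topologicalClosure (p := p) hq1 hqt.ne]; trivial
  obtain ⟨a, ⟨η, hη, ha⟩, had⟩ := Metric.mem_closure_iff.1 hcl (ε / (2 * R)) (by positivity)
  have hBa : ∀ b, B a b = ∫ x, η x * b x ∂ballMeasure m := by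
    intro b
    rw [hBe]
    refine integral_congr_ae ?_
    filter_upwards [ha] with x hx
    rw [hx]
  obtain ⟨n₀, hn₀⟩ := Metric.tendsto_atTop.1 (h η hη) (ε / 2) (by positivity)
  refine ⟨n₀, fun n hn => ?_⟩
  have h1 := hn₀ n hn
  rw [← hBa, ← hBa, Real.dist_eq, ← map_sub] at h1
  rw [Real.dist_eq, ← map_sub, hLB]
  have h2 : B hk.toLp (f n - g) = B (hk.toLp - a) (f n - g) + B a (f n - g) := by
    rw [map_sub B, _root_.sub_apply]; ring
  have h3 : |B (hk.toLp - a) (f n - g)| ≤ ε / 2 := by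
    rw [← Real.norm_eq_abs]
    refine (B.le_opNorm₂ _ _).trans ?_
    rw [dist_eq_norm] at had
    have h4 : ‖f n - g‖ ≤ |K| + ‖g‖ :=
      (norm_sub_le _ _).trans (by have := (hK n).trans (le_abs_self K); linarith)
    calc ‖B‖ * ‖hk.toLp - a‖ * ‖f n - g‖
        ≤ ‖B‖ * (ε / (2 * R)) * (|K| + ‖g‖) := by gcongr
      _ = (‖B‖ * (|K| + ‖g‖)) * (ε / (2 * R)) := by ring
      _ ≤ R * (ε / (2 * R)) := by gcongr; rw [hR]; linarith
      _ = ε / 2 := by field_simp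
  rw [h2]
  exact (abs_add_le _ _).trans_lt (by linarith)

/-- A bounded sequence in `L^p`, `1 < p < ∞`, with values in a finite-dimensional space, that
converges against all test functions converges weakly. -/
theorem tendsto_dual_of_tendsto_test {F : Type*} [NormedAddCommGroup F] [NormedSpace ℝ F]
    [FiniteDimensional ℝ F] [Fact (1 ≤ p)] (hp1 : 1 < p) (hp : p ≠ ⊤)
    {f : ℕ → Lp F p (ballMeasure m)} {g : Lp F p (ballMeasure m)} {K : ℝ} (hK : ∀ n, ‖f n‖ ≤ K)
    (h : ∀ η : Euc m → ℝ, IsBallTest η →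
      Tendsto (fun n => ∫ x, η x • f n x ∂ballMeasure m) atTop
        (𝓝 (∫ x, η x • g x ∂ballMeasure m)))
    (L : Lp F p (ballMeasure m) →L[ℝ] ℝ) : Tendsto (fun n => L (f n)) atTop (𝓝 (L g)) := by
  set b := Module.finBasis ℝ F
  set co : Fin (Module.finrank ℝ F) → F →L[ℝ] ℝ := fun i => (b.coord i).toContinuousLinearMap
  set em : Fin (Module.finrank ℝ F) → ℝ →L[ℝ] F := fun i =>
    ContinuousLinearMap.toSpanSingleton ℝ (b i)
  have hdec : ∀ a : Lp F p (ballMeasure m),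
      a = ∑ i, (em i).compLp ((co i).compLp a) := by
    intro a
    ext1
    have h1 : ∀ᵐ x ∂ballMeasure m, ∀ i, (em i).compLp ((co i).compLp a) x = co i (a x) • b i := by
      rw [ae_all_iff]
      intro i
      filter_upwards [(em i).coeFn_compLp ((co i).compLp a), (co i).coeFn_compLp a] with x h1 h2
      rw [h1, h2]; simp [em]
    filter_upwards [Lp.coeFn_finsetSum Finset.univ fun i => (em i).compLp ((co i).compLp a), h1]
      with x h2 h3
    rw [h2, Finset.sum_apply, Finset.sum_congr rfl fun i _ => h3 i]
    exact (b.sum_repr (a x)).symm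
  have hL : ∀ a, L a = ∑ i, (L.comp ((em i).compLpL p (ballMeasure m))) ((co i).compLp a) := by
    intro a
    conv_lhs => rw [hdec a]
    rw [map_sum]; rfl
  simp_rw [hL]
  refine tendsto_finsetSum _ fun i _ => ?_
  refine tendsto_dual_of_tendsto_test_real hp1 hp (K := ‖co i‖ * K) (fun n => ?_)
    (fun η hη => ?_) _
  · exact ((co i).norm_compLp_le _).trans (mul_le_mul_of_nonneg_left (hK n) (norm_nonneg _))
  · have hint : ∀ a : Lp F p (ballMeasure m), ∫ x, η x * ((co i).compLp a) x ∂ballMeasure m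
        = co i (∫ x, η x • a x ∂ballMeasure m) := by
      intro a
      obtain ⟨C, hC⟩ := hη.2.1.exists_bound_of_continuous hη.1.continuous
      have hI : Integrable (fun x => η x • a x) (ballMeasure m) :=
        ((Lp.memLp a).integrable Fact.out).bdd_smul C
          hη.1.continuous.aestronglyMeasurable (ae_of_all _ hC)
      rw [← (co i).integral_comp_comm hI]
      refine integral_congr_ae ?_
      filter_upwards [(co i).coeFn_compLp a] with x hx
      rw [hx, map_smul, smul_eq_mul]
    simp_rw [hint]
    exact ((co i).continuous.tendsto _).comp (h η hη)

end WeakConvergence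

section Sobolev

variable {m ℓ : ℕ} {p : ℝ≥0∞}

theorem tendsto_toWeakSpace_iff {E : Type*} [NormedAddCommGroup E] [NormedSpace ℝ E]
    {w : ℕ → E} {u : E} :
    Tendsto (fun n => toWeakSpace ℝ E (w n)) atTop (𝓝 (toWeakSpace ℝ E u)) ↔
      ∀ L : E →L[ℝ] ℝ, Tendsto (fun n => L (w n)) atTop (𝓝 (L u)) := by
  refine ⟨fun h L => ?_, fun h => ?_⟩
  · exact ((WeakBilin.eval_continuous (topDualPairing ℝ E).flip L).tendsto _).comp h
  · have hi : Topology.IsInducing fun (x : WeakBilin (topDualPairing ℝ E).flip) y =>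
        (topDualPairing ℝ E).flip x y := ⟨rfl⟩
    exact hi.tendsto_nhds_iff.2 (tendsto_pi_nhds.2 h)

theorem exists_dual_prod_of_submodule {X Y : Type*} [NormedAddCommGroup X] [NormedSpace ℝ X]
    [NormedAddCommGroup Y] [NormedSpace ℝ Y] (S : Submodule ℝ (X × Y)) (L : S →L[ℝ] ℝ) :
    ∃ (L₁ : X →L[ℝ] ℝ) (L₂ : Y →L[ℝ] ℝ), ∀ a : S, L a = L₁ a.1.1 + L₂ a.1.2 := by
  obtain ⟨L', hL', -⟩ := exists_extension_norm_eq S L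
  refine ⟨L'.comp (.inl ℝ X Y), L'.comp (.inr ℝ X Y), fun a => ?_⟩
  rw [← hL' a, ContinuousLinearMap.comp_apply, ContinuousLinearMap.comp_apply, ← map_add]
  congr 1
  ext1 <;> simp

theorem tendsto_clm_of_forall_apply {ι E F : Type*} [NormedAddCommGroup E] [NormedSpace ℝ E]
    [FiniteDimensional ℝ E] [NormedAddCommGroup F] [NormedSpace ℝ F] {l : Filter ι}
    {f : ι → E →L[ℝ] F} {g : E →L[ℝ] F} (h : ∀ v, Tendsto (fun i => f i v) l (𝓝 (g v))) :
    Tendsto f l (𝓝 g) := by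
  let e : (E →L[ℝ] F) ≃L[ℝ] Fin (Module.finrank ℝ E) → F :=
    ((ContinuousLinearEquiv.ofFinrankEq (Module.finrank_fin_fun ℝ).symm).arrowCongr
      (1 : F ≃L[ℝ] F)).trans (ContinuousLinearEquiv.piRing _)
  rw [e.toHomeomorph.isInducing.tendsto_nhds_iff]
  exact tendsto_pi_nhds.2 fun i => h _

theorem IsBallTest.fderiv_apply {E : Type*} [NormedAddCommGroup E] [NormedSpace ℝ E]
    {φ : Euc m → E} (hφ : IsBallTest φ) (v : Euc m) : IsBallTest fun x => fderiv ℝ φ x v :=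
  ⟨(hφ.1.fderiv_right (m := ∞) (by simp)).clm_apply contDiff_const, hφ.2.1.fderiv_apply ℝ v,
    (tsupport_fderiv_apply_subset ℝ v).trans hφ.2.2⟩

theorem integrable_smul_of_continuousOn {F : Type*} [NormedAddCommGroup F] [NormedSpace ℝ F]
    {φ : Euc m → ℝ} (hφ : Continuous φ) (hc : HasCompactSupport φ) {U : Set (Euc m)}
    (hs : tsupport φ ⊆ U) {f : Euc m → F} (hf : ContinuousOn f U) :
    Integrable fun x => φ x • f x := by
  rw [← integrableOn_iff_integrable_of_support_subset (s := tsupport φ)]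
  · exact (hφ.continuousOn.smul (hf.mono hs)).integrableOn_compact hc
  · exact (Function.support_smul_subset_left φ f).trans (subset_tsupport φ)

/-- The classical derivative of a `C^1` map on the open ball is its weak derivative. -/
theorem isWeakDerivOnBall_fderiv {g : Euc m → Euc ℓ}
    (hg : ContDiffOn ℝ 1 g (Metric.ball 0 1)) : IsWeakDerivOnBall g (fderiv ℝ g) := by
  intro φ hφ v
  have hd := hg.continuousOn_fderiv_of_isOpen Metric.isOpen_ball le_rfl
  have hv := hφ.fderiv_apply v
  have h1 := integral_smul_fderiv_eq_neg_fderiv_smul_of_integrable (μ := volume) (f := φ) (g := g)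
    (v := v) (integrable_smul_of_continuousOn hv.1.continuous hv.2.1 hv.2.2 hg.continuousOn)
    (integrable_smul_of_continuousOn hφ.1.continuous hφ.2.1 hφ.2.2
      (hd.clm_apply continuousOn_const))
    (integrable_smul_of_continuousOn hφ.1.continuous hφ.2.1 hφ.2.2 hg.continuousOn)
    (fun x _ => hφ.1.differentiable (by simp) x)
    (fun x hx => (hg.differentiableOn one_ne_zero).differentiableAt
      (Metric.isOpen_ball.mem_nhds (hφ.2.2 hx)))
  rw [setIntegral_eq_integral_of_forall_compl_eq_zero,
    setIntegral_eq_integral_of_forall_compl_eq_zero, h1, neg_neg]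
  · intro x hx
    rw [image_eq_zero_of_notMem_tsupport (fun hx' => hx (hφ.2.2 hx')), zero_smul]
  · intro x hx
    have := image_eq_zero_of_notMem_tsupport (f := fun x => fderiv ℝ φ x v)
      (fun hx' => hx (hv.2.2 hx'))
    rw [this, zero_smul]

theorem IsWeakDerivOnBall.congr_ae {u u' : Euc m → Euc ℓ} {G G' : Euc m → Euc m →L[ℝ] Euc ℓ}
    (h : IsWeakDerivOnBall u G) (hu : u =ᵐ[ballMeasure m] u') (hG : G =ᵐ[ballMeasure m] G') :
    IsWeakDerivOnBall u' G' := by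
  intro φ hφ v
  have h1 : ∫ x, (fderiv ℝ φ x v) • u' x ∂ballMeasure m
      = ∫ x, (fderiv ℝ φ x v) • u x ∂ballMeasure m := by
    refine integral_congr_ae ?_
    filter_upwards [hu] with x hx
    rw [hx]
  have h2 : ∫ x, φ x • G' x v ∂ballMeasure m = ∫ x, φ x • G x v ∂ballMeasure m := by
    refine integral_congr_ae ?_
    filter_upwards [hG] with x hx
    rw [hx]
  rw [h1, h2, h φ hφ v]

/-- The element of `W^{1,p}` given by an `L^p` function with an `L^p` weak derivative. -/
noncomputable def W1p.of [Fact (1 ≤ p)] {f : Euc m → Euc ℓ} {G : Euc m → Euc m →L[ℝ] Euc ℓ}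
    (hf : MemLp f p (ballMeasure m)) (hG : MemLp G p (ballMeasure m))
    (h : IsWeakDerivOnBall f G) : W1p m ℓ p :=
  ⟨(hf.toLp, hG.toLp), h.congr_ae hf.coeFn_toLp.symm hG.coeFn_toLp.symm⟩

/-- The weak derivative of an element of `W^{1,p}` with a `C^1` representative is the classical
derivative. -/
theorem W1p.snd_ae_eq_fderiv [Fact (1 ≤ p)] (w : W1p m ℓ p) {g : Euc m → Euc ℓ}
    (hg : ContDiffOn ℝ 1 g (Metric.ball 0 1)) (hw : reprFun w =ᵐ[ballMeasure m] g) :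
    w.1.2 =ᵐ[ballMeasure m] fderiv ℝ g := by
  have h1 : IsWeakDerivOnBall g w.1.2 := IsWeakDerivOnBall.congr_ae w.2 hw .rfl
  have h2 := isWeakDerivOnBall_fderiv hg
  have h3 : (fun x => w.1.2 x - fderiv ℝ g x) =ᵐ[ballMeasure m] 0 := by
    have hd := hg.continuousOn_fderiv_of_isOpen Metric.isOpen_ball le_rfl
    have hi := (Lp.memLp w.1.2).integrable (Fact.out : 1 ≤ p)
    have h1' := Metric.isOpen_ball.ae_eq_zero_of_integral_contDiff_smul_eq_zero
      (E := Euc m) (μ := volume) (U := Metric.ball (0 : Euc m) 1)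
      (f := fun x => w.1.2 x - fderiv ℝ g x)
      ((IntegrableOn.locallyIntegrableOn hi).sub (hd.locallyIntegrableOn measurableSet_ball))
      (fun η e1 e2 e3 => ?_)
    · exact (ae_restrict_iff' measurableSet_ball).2 h1'
    · have hη : IsBallTest η := ⟨e1, e2, e3⟩
      obtain ⟨C, hC⟩ := hη.2.1.exists_bound_of_continuous hη.1.continuous
      have i1 : Integrable (fun x => η x • w.1.2 x) (ballMeasure m) :=
        hi.bdd_smul C hη.1.continuous.aestronglyMeasurable (ae_of_all _ hC)
      have i2 : Integrable (fun x => η x • fderiv ℝ g x) (ballMeasure m) :=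
        (integrable_smul_of_continuousOn e1.continuous e2 e3 hd).restrict
      rw [← setIntegral_eq_integral_of_forall_compl_eq_zero (s := Metric.ball (0 : Euc m) 1)]
      · simp_rw [smul_sub]
        rw [integral_sub i1 i2, sub_eq_zero]
        ext1 v
        rw [ContinuousLinearMap.integral_apply i1 v, ContinuousLinearMap.integral_apply i2 v]
        exact neg_inj.1 ((h1 η hη v).symm.trans (h2 η hη v))
      · intro x hx
        rw [image_eq_zero_of_notMem_tsupport (fun hx' => hx (e3 hx'))]
        exact zero_smul ℝ (w.1.2 x - fderiv ℝ g x)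
  filter_upwards [h3] with x hx
  exact sub_eq_zero.1 hx

/-- Integration against a bounded function, as a continuous linear map on `L^p`. -/
theorem exists_integral_smul_clm {α F : Type*} [MeasurableSpace α] {μ : Measure α}
    [IsFiniteMeasure μ] [NormedAddCommGroup F] [NormedSpace ℝ F] [CompleteSpace F]
    [hp : Fact (1 ≤ p)] {η : α → ℝ} (hη : AEStronglyMeasurable η μ) {C : ℝ}
    (hC : ∀ᵐ x ∂μ, ‖η x‖ ≤ C) :
    ∃ Λ : Lp F p μ →L[ℝ] F, ∀ f, Λ f = ∫ x, η x • f x ∂μ := by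
  have : ENNReal.HolderConjugate p p.conjExponent := ENNReal.HolderConjugate.conjExponent hp.out
  have : Fact (1 ≤ p.conjExponent) := ⟨ENNReal.HolderConjugate.one_le _ p⟩
  have hm : MemLp η p.conjExponent μ := MemLp.of_bound hη C hC
  refine ⟨(ContinuousLinearMap.lsmul ℝ ℝ).lpPairing μ p.conjExponent p hm.toLp, fun f => ?_⟩
  rw [ContinuousLinearMap.lpPairing_eq_integral]
  refine integral_congr_ae ?_
  filter_upwards [hm.coeFn_toLp] with x hx
  rw [hx, ContinuousLinearMap.lsmul_apply]

theorem IsBallTest.exists_integral_smul_clm {F : Type*} [NormedAddCommGroup F] [NormedSpace ℝ F]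
    [CompleteSpace F] [Fact (1 ≤ p)] {η : Euc m → ℝ} (hη : IsBallTest η) :
    ∃ Λ : Lp F p (ballMeasure m) →L[ℝ] F, ∀ f, Λ f = ∫ x, η x • f x ∂ballMeasure m := by
  obtain ⟨C, hC⟩ := hη.2.1.exists_bound_of_continuous hη.1.continuous
  exact _root_.exists_integral_smul_clm hη.1.continuous.aestronglyMeasurable (ae_of_all _ hC)

theorem IsBallTest.integral_smul_apply {η : Euc m → ℝ} (hη : IsBallTest η) [Fact (1 ≤ p)]
    (G : Lp (Euc m →L[ℝ] Euc ℓ) p (ballMeasure m)) (v : Euc m) :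
    (∫ x, η x • G x ∂ballMeasure m) v = ∫ x, η x • G x v ∂ballMeasure m := by
  obtain ⟨C, hC⟩ := hη.2.1.exists_bound_of_continuous hη.1.continuous
  have i1 : Integrable (fun x => η x • G x) (ballMeasure m) :=
    ((Lp.memLp G).integrable Fact.out).bdd_smul C hη.1.continuous.aestronglyMeasurable
      (ae_of_all _ hC)
  rw [ContinuousLinearMap.integral_apply i1 v]
  rfl

theorem isClosed_W1p [Fact (1 ≤ p)] :
    IsClosed (W1p m ℓ p : Set (Lp (Euc ℓ) p (ballMeasure m) ×
      Lp (Euc m →L[ℝ] Euc ℓ) p (ballMeasure m))) := by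
  have : (W1p m ℓ p : Set (Lp (Euc ℓ) p (ballMeasure m) ×
      Lp (Euc m →L[ℝ] Euc ℓ) p (ballMeasure m))) = ⋂ (φ : Euc m → ℝ) (_ : IsBallTest φ) (v : Euc m),
      {w | ∫ x, (fderiv ℝ φ x v) • w.1 x ∂ballMeasure m
        = - ∫ x, φ x • w.2 x v ∂ballMeasure m} := by
    ext w
    simp only [Set.mem_iInter]
    rfl
  rw [this]
  refine isClosed_iInter fun φ => isClosed_iInter fun hφ => isClosed_iInter fun v => ?_
  obtain ⟨Λ₁, h₁⟩ := (hφ.fderiv_apply v).exists_integral_smul_clm (F := Euc ℓ) (p := p)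
  obtain ⟨Λ₂, h₂⟩ := hφ.exists_integral_smul_clm (F := Euc m →L[ℝ] Euc ℓ) (p := p)
  simp_rw [← h₁, ← hφ.integral_smul_apply, ← h₂]
  exact isClosed_eq (Λ₁.continuous.comp continuous_fst)
    (((Λ₂.continuous.comp continuous_snd).clm_apply continuous_const).neg)

/-- A bounded sequence of `W^{1,p}`, `1 < p < ∞`, whose functions converge against all test
functions converges weakly. -/
theorem W1p.tendsto_toWeakSpace [Fact (1 ≤ p)] (hp1 : 1 < p) (hp : p ≠ ⊤)
    {w : ℕ → W1p m ℓ p} {u : W1p m ℓ p} {K : ℝ} (hK : ∀ n, ‖w n‖ ≤ K)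
    (h : ∀ η : Euc m → ℝ, IsBallTest η →
      Tendsto (fun n => ∫ x, η x • reprFun (w n) x ∂ballMeasure m) atTop
        (𝓝 (∫ x, η x • reprFun u x ∂ballMeasure m))) :
    Tendsto (fun n => toWeakSpace ℝ (W1p m ℓ p) (w n)) atTop
      (𝓝 (toWeakSpace ℝ (W1p m ℓ p) u)) := by
  suffices H : ∀ L : W1p m ℓ p →L[ℝ] ℝ, Tendsto (fun n => L (w n)) atTop (𝓝 (L u)) by
    exact tendsto_toWeakSpace_iff.2 H
  intro L
  obtain ⟨L₁, L₂, hd⟩ := exists_dual_prod_of_submodule (W1p m ℓ p) L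
  simp_rw [hd]
  refine Tendsto.add ?_ ?_
  · exact tendsto_dual_of_tendsto_test hp1 hp
      (fun n => (norm_fst_le (w n).1).trans (hK n)) h _
  · refine tendsto_dual_of_tendsto_test hp1 hp
      (fun n => (norm_snd_le (w n).1).trans (hK n)) (fun η hη => ?_) _
    refine tendsto_clm_of_forall_apply fun v => ?_
    simp_rw [hη.integral_smul_apply]
    have h1 := (h _ (hη.fderiv_apply v)).neg
    have h2 : ∀ a : W1p m ℓ p, ∫ x, η x • a.1.2 x v ∂ballMeasure m
        = - ∫ x, fderiv ℝ η x v • reprFun a x ∂ballMeasure m := fun a => by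
      rw [← neg_eq_iff_eq_neg]; exact (a.2 η hη v).symm
    simp_rw [h2]
    exact h1

theorem tendsto_of_tendsto_toWeakSpace {E F : Type*} [NormedAddCommGroup E] [NormedSpace ℝ E]
    [NormedAddCommGroup F] [NormedSpace ℝ F] [FiniteDimensional ℝ F] {w : ℕ → E} {u : E}
    (h : Tendsto (fun n => toWeakSpace ℝ E (w n)) atTop (𝓝 (toWeakSpace ℝ E u)))
    (Λ : E →L[ℝ] F) : Tendsto (fun n => Λ (w n)) atTop (𝓝 (Λ u)) := by
  have H : ∀ L : E →L[ℝ] ℝ, Tendsto (fun n => L (w n)) atTop (𝓝 (L u)) :=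
    tendsto_toWeakSpace_iff.1 h
  set b := Module.finBasis ℝ F
  have hb : ∀ a, Λ a = ∑ i, ((b.coord i).toContinuousLinearMap.comp Λ) a • b i := fun a =>
    (b.sum_repr (Λ a)).symm
  simp_rw [hb]
  exact tendsto_finsetSum _ fun i _ => (H _).smul_const _

theorem exists_norm_le_of_tendsto_toWeakSpace {E : Type*} [NormedAddCommGroup E] [NormedSpace ℝ E]
    {w : ℕ → E} {u : E}
    (h : Tendsto (fun n => toWeakSpace ℝ E (w n)) atTop (𝓝 (toWeakSpace ℝ E u))) :
    ∃ K, ∀ n, ‖w n‖ ≤ K := by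
  obtain ⟨K, hK⟩ := banach_steinhaus (g := fun n => NormedSpace.inclusionInDoubleDual ℝ E (w n))
    fun L => by
      obtain ⟨C, hC⟩ := (tendsto_of_tendsto_toWeakSpace h L).norm.bddAbove_range
      exact ⟨C, fun n => hC ⟨n, rfl⟩⟩
  refine ⟨K, fun n => ?_⟩
  have := hK n
  rwa [show ‖NormedSpace.inclusionInDoubleDual ℝ E (w n)‖ = ‖w n‖ from
    (NormedSpace.inclusionInDoubleDualLi ℝ).norm_map (w n)] at this

end Sobolev

section Fibration

/-- A smooth map `Φ : ℝⁿ → ℝᵐ` whose fibres over the closed unit ball stay inside the open unit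
ball, together with a local trivialisation `Ψ` over `𝔹ᵐ × [0, h]`; both are compatible with
Lebesgue measure up to constants. -/
structure IsBallFibration {m n : ℕ} (Φ : Euc n → Euc m) (Ψ : Euc m × ℝ → Euc n) (h : ℝ)
    (c₁ c₂ : NNReal) : Prop where
  pos : 0 < h
  contDiff : ContDiff ℝ ∞ Φ
  preimage_subset : Φ ⁻¹' Metric.closedBall 0 1 ⊆ Metric.ball 0 1
  map_le : ((ballMeasure n).restrict (Φ ⁻¹' Metric.ball 0 1)).map Φ ≤ c₁ • ballMeasure m
  continuous : Continuous Ψ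
  contDiffAt : ∀ z ∈ Metric.closedBall (0 : Euc m) 1 ×ˢ Set.Icc 0 h, ContDiffAt ℝ ∞ Ψ z
  mem_ball : ∀ z ∈ Metric.closedBall (0 : Euc m) 1 ×ˢ Set.Icc 0 h, Ψ z ∈ Metric.ball 0 1
  right_inv : ∀ z ∈ Metric.closedBall (0 : Euc m) 1 ×ˢ Set.Icc 0 h, Φ (Ψ z) = z.1
  map_prod_le : ((ballMeasure m).prod (volume.restrict (Set.Ioo 0 h))).map Ψ
    ≤ c₂ • ballMeasure n

namespace IsBallFibration

variable {m n ℓ : ℕ} {Φ : Euc n → Euc m} {Ψ : Euc m × ℝ → Euc n} {h : ℝ} {c₁ c₂ : NNReal}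
  {p : ℝ≥0∞}

theorem isBallTest_comp (H : IsBallFibration Φ Ψ h c₁ c₂) {E : Type*} [NormedAddCommGroup E]
    [NormedSpace ℝ E] {φ : Euc m → E} (hφ : IsBallTest φ) : IsBallTest (φ ∘ Φ) := by
  have h1 : tsupport (φ ∘ Φ) ⊆ Metric.ball 0 1 := by
    refine (tsupport_comp_subset_preimage φ H.contDiff.continuous).trans ?_
    exact (Set.preimage_mono (hφ.2.2.trans Metric.ball_subset_closedBall)).trans H.preimage_subset
  refine ⟨hφ.1.comp H.contDiff, ?_, h1⟩
  exact (isCompact_closedBall (0 : Euc n) 1).of_isClosed_subset (isClosed_tsupport _)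
    (h1.trans Metric.ball_subset_closedBall)

theorem isWeightedComp_fst (H : IsBallFibration Φ Ψ h c₁ c₂) (ℓ : ℕ) :
    IsWeightedComp (ballMeasure n) (ballMeasure m) Φ (Φ ⁻¹' Metric.ball 0 1)
      ((Φ ⁻¹' Metric.ball 0 1).indicator fun _ => ContinuousLinearMap.id ℝ (Euc ℓ)) c₁ 1 where
  measurable := H.contDiff.continuous.measurable
  measurableSet := H.contDiff.continuous.measurable measurableSet_ball
  map_le := H.map_le
  weight := aestronglyMeasurable_const.indicator
    (H.contDiff.continuous.measurable measurableSet_ball)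
  bound := fun _ => (norm_indicator_le_norm_self _ _).trans ContinuousLinearMap.norm_id_le
  zero := fun _ hy => Set.indicator_of_notMem hy _

theorem exists_isWeightedComp_snd (H : IsBallFibration Φ Ψ h c₁ c₂) (ℓ : ℕ) :
    ∃ M : NNReal, IsWeightedComp (ballMeasure n) (ballMeasure m) Φ (Φ ⁻¹' Metric.ball 0 1)
      ((Φ ⁻¹' Metric.ball 0 1).indicator fun y =>
        (ContinuousLinearMap.compL ℝ (Euc n) (Euc m) (Euc ℓ)).flip (fderiv ℝ Φ y)) c₁ M := by
  have hS := H.contDiff.continuous.measurable (measurableSet_ball (x := (0 : Euc m)) (ε := 1))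
  have hc : Continuous fun y =>
      (ContinuousLinearMap.compL ℝ (Euc n) (Euc m) (Euc ℓ)).flip (fderiv ℝ Φ y) :=
    (ContinuousLinearMap.continuous _).comp (H.contDiff.continuous_fderiv (by simp))
  obtain ⟨M, hM⟩ := (isCompact_closedBall (0 : Euc n) 1).exists_bound_of_continuousOn
    hc.continuousOn
  refine ⟨M.toNNReal, H.contDiff.continuous.measurable, hS, H.map_le,
    hc.aestronglyMeasurable.indicator hS, fun y => ?_, fun y hy => Set.indicator_of_notMem hy _⟩
  by_cases hy : y ∈ Φ ⁻¹' Metric.ball 0 1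
  · rw [Set.indicator_of_mem hy]
    refine (hM y ?_).trans (Real.le_coe_toNNReal M)
    exact Metric.ball_subset_closedBall (H.preimage_subset (Metric.ball_subset_closedBall hy))
  · rw [Set.indicator_of_notMem hy, norm_zero]; exact NNReal.coe_nonneg _

/-- Composition with `Φ`, extended by zero, on functions. -/
noncomputable def pullFst [Fact (1 ≤ p)] (H : IsBallFibration Φ Ψ h c₁ c₂) (hp : p ≠ ⊤) (ℓ : ℕ) :
    Lp (Euc ℓ) p (ballMeasure m) →L[ℝ] Lp (Euc ℓ) p (ballMeasure n) :=
  (H.isWeightedComp_fst ℓ).toCLM hp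

/-- The action of composition with `Φ` on derivatives. -/
noncomputable def pullSnd [Fact (1 ≤ p)] (H : IsBallFibration Φ Ψ h c₁ c₂) (hp : p ≠ ⊤) (ℓ : ℕ) :
    Lp (Euc m →L[ℝ] Euc ℓ) p (ballMeasure m) →L[ℝ] Lp (Euc n →L[ℝ] Euc ℓ) p (ballMeasure n) :=
  (H.exists_isWeightedComp_snd ℓ).choose_spec.toCLM hp

theorem pullFst_test [Fact (1 ≤ p)] (H : IsBallFibration Φ Ψ h c₁ c₂) (hp : p ≠ ⊤)
    {w : W1p m ℓ p} {φ : Euc m → Euc ℓ} (hφ : IsBallTest φ) (hw : reprFun w =ᵐ[ballMeasure m] φ) :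
    H.pullFst hp ℓ w.1.1 =ᵐ[ballMeasure n] φ ∘ Φ := by
  filter_upwards [(H.isWeightedComp_fst ℓ).coeFn_toCLM hp w.1.1,
    (H.isWeightedComp_fst ℓ).congr_ae hw] with y h1 h2
  rw [pullFst, h1]
  refine h2.trans ?_
  by_cases hy : y ∈ Φ ⁻¹' Metric.ball 0 1
  · rw [Set.indicator_of_mem hy]; rfl
  · rw [Set.indicator_of_notMem hy, Function.comp_apply, zero_apply,
      image_eq_zero_of_notMem_tsupport fun h' => hy (hφ.2.2 h')]

theorem pullSnd_test [Fact (1 ≤ p)] (H : IsBallFibration Φ Ψ h c₁ c₂) (hp : p ≠ ⊤)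
    {w : W1p m ℓ p} {φ : Euc m → Euc ℓ} (hφ : IsBallTest φ) (hw : reprFun w =ᵐ[ballMeasure m] φ) :
    H.pullSnd hp ℓ w.1.2 =ᵐ[ballMeasure n] fderiv ℝ (φ ∘ Φ) := by
  have hd := W1p.snd_ae_eq_fderiv w ((hφ.1.of_le (by simp)).contDiffOn) hw
  have K := (H.exists_isWeightedComp_snd ℓ).choose_spec
  filter_upwards [K.coeFn_toCLM hp w.1.2, K.congr_ae hd] with y h1 h2
  rw [pullSnd, h1]
  refine h2.trans ?_
  rw [fderiv_comp y (hφ.1.differentiable (by simp) _) (H.contDiff.differentiable (by simp) _)]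
  by_cases hy : y ∈ Φ ⁻¹' Metric.ball 0 1
  · rw [Set.indicator_of_mem hy]; rfl
  · rw [Set.indicator_of_notMem hy, zero_apply]
    have : fderiv ℝ φ (Φ y) = 0 := image_eq_zero_of_notMem_tsupport
      fun h' => hy (hφ.2.2 (tsupport_fderiv_subset ℝ h'))
    rw [this, ContinuousLinearMap.zero_comp]

theorem exists_pull_mem_W1pZero [Fact (1 ≤ p)] (H : IsBallFibration Φ Ψ h c₁ c₂) (hp : p ≠ ⊤)
    {w : W1p m ℓ p} (hw : w ∈ W1pZero m ℓ p) :
    ∃ w' ∈ W1pZero n ℓ p, w'.1 = (H.pullFst hp ℓ w.1.1, H.pullSnd hp ℓ w.1.2) := by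
  have hcl : IsClosed ((fun w' : W1p n ℓ p => w'.1) '' W1pZero n ℓ p) :=
    isClosed_W1p.isClosedEmbedding_subtypeVal.isClosedMap _ isClosed_closure
  have hcont : Continuous fun w : W1p m ℓ p =>
      (H.pullFst hp ℓ w.1.1, H.pullSnd hp ℓ w.1.2) :=
    ((H.pullFst hp ℓ).continuous.comp (continuous_fst.comp continuous_subtype_val)).prodMk
      ((H.pullSnd hp ℓ).continuous.comp (continuous_snd.comp continuous_subtype_val))
  refine closure_minimal ?_ (hcl.preimage hcont) hw
  rintro w ⟨φ, hφ, hwφ⟩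
  have ht := H.isBallTest_comp hφ
  have h1 := H.pullFst_test hp hφ hwφ
  have h2 := H.pullSnd_test hp hφ hwφ
  refine ⟨⟨(H.pullFst hp ℓ w.1.1, H.pullSnd hp ℓ w.1.2), ?_⟩, subset_closure ⟨φ ∘ Φ, ht, h1⟩, rfl⟩
  exact (isWeakDerivOnBall_fderiv (ht.1.of_le (by simp)).contDiffOn).congr_ae h1.symm h2.symm

end IsBallFibration

/-- The constant map `c`, as an element of `W^{1,p}`. -/
noncomputable def W1p.const (m : ℕ) {ℓ : ℕ} (p : ℝ≥0∞) [Fact (1 ≤ p)] (c : Euc ℓ) : W1p m ℓ p :=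
  W1p.of (f := fun _ => c) (G := fun _ => 0) (memLp_const c) (memLp_const 0) (by
    have := isWeakDerivOnBall_fderiv (m := m) (g := fun _ => c) contDiffOn_const
    rwa [fderiv_fun_const] at this)

theorem W1p.reprFun_const (m : ℕ) {ℓ : ℕ} (p : ℝ≥0∞) [Fact (1 ≤ p)] (c : Euc ℓ) :
    reprFun (W1p.const m p c) =ᵐ[ballMeasure m] fun _ => c :=
  (memLp_const c).coeFn_toLp

theorem reprFun_add {m ℓ : ℕ} {p : ℝ≥0∞} [Fact (1 ≤ p)] (a b : W1p m ℓ p) :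
    reprFun (a + b) =ᵐ[ballMeasure m] fun x => reprFun a x + reprFun b x :=
  Lp.coeFn_add a.1.1 b.1.1

namespace IsBallFibration

variable {m n ℓ : ℕ} {Φ : Euc n → Euc m} {Ψ : Euc m × ℝ → Euc n} {h : ℝ} {c₁ c₂ : NNReal}
  {p : ℝ≥0∞}

theorem add_pull_mem_W1pConst [Fact (1 ≤ p)] (H : IsBallFibration Φ Ψ h c₁ c₂) (hp : p ≠ ⊤)
    {N : Set (Euc ℓ)} {u w : W1p m ℓ p} (hu : u ∈ W1pInto m p N) {c : Euc ℓ} (hc : c ∈ N)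
    (huw : reprFun u =ᵐ[ballMeasure m] fun x => c + reprFun w x)
    {w' : W1p n ℓ p} (hw' : w' ∈ W1pZero n ℓ p) (h1 : w'.1.1 = H.pullFst hp ℓ w.1.1) :
    W1p.const n p c + w' ∈ W1pConst n p N := by
  have e1 : reprFun (W1p.const n p c + w') =ᵐ[ballMeasure n] fun y => c + reprFun w' y := by
    filter_upwards [reprFun_add (W1p.const n p c) w', W1p.reprFun_const n p c] with y h1 h2
    rw [h1, h2]
  refine ⟨?_, c, hc, w', hw', e1⟩
  have K := H.isWeightedComp_fst ℓ
  have e2 : ∀ᵐ x ∂ballMeasure m, c + reprFun w x ∈ N := by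
    filter_upwards [hu, huw] with x h1 h2
    rwa [← h2]
  have e3 := ae_restrict_comp_of_map_le K.measurable K.map_le e2
  rw [ae_restrict_iff' K.measurableSet] at e3
  have e4 : reprFun w' = H.pullFst hp ℓ w.1.1 := by rw [reprFun, h1]
  filter_upwards [e1, e3, K.coeFn_toCLM hp w.1.1] with y h1 h2 h3
  rw [h1, e4, pullFst, h3]
  by_cases hy : y ∈ Φ ⁻¹' Metric.ball 0 1
  · rw [Set.indicator_of_mem hy]; exact h2 hy
  · rw [Set.indicator_of_notMem hy, zero_apply, add_zero]; exact hc

end IsBallFibration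
end Fibration

namespace IsBallFibration

variable {m n ℓ : ℕ} {Φ : Euc n → Euc m} {Ψ : Euc m × ℝ → Euc n} {h : ℝ} {c₁ c₂ : NNReal}
  {p : ℝ≥0∞}

theorem ae_mem_box (m : ℕ) (h : ℝ) :
    ∀ᵐ z ∂(ballMeasure m).prod (volume.restrict (Set.Ioo 0 h)),
      z ∈ Metric.ball (0 : Euc m) 1 ×ˢ Set.Ioo 0 h := by
  rw [Measure.prod_restrict]
  exact ae_restrict_mem (measurableSet_ball.prod measurableSet_Ioo)

theorem box_subset (m : ℕ) (h : ℝ) : Metric.ball (0 : Euc m) 1 ×ˢ Set.Ioo 0 h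
    ⊆ Metric.closedBall (0 : Euc m) 1 ×ˢ Set.Icc 0 h :=
  Set.prod_mono Metric.ball_subset_closedBall Set.Ioo_subset_Icc_self

/-- Composition with `Ψ`, weighted by a continuous field of operators. -/
theorem exists_isWeightedComp (H : IsBallFibration Φ Ψ h c₁ c₂) {F F' : Type*}
    [NormedAddCommGroup F] [NormedSpace ℝ F] [NormedAddCommGroup F'] [NormedSpace ℝ F']
    {A : Euc m × ℝ → F →L[ℝ] F'}
    (hA : ContinuousOn A (Metric.closedBall (0 : Euc m) 1 ×ˢ Set.Icc 0 h)) :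
    ∃ M : NNReal, IsWeightedComp ((ballMeasure m).prod (volume.restrict (Set.Ioo 0 h)))
      (ballMeasure n) Ψ (Metric.ball (0 : Euc m) 1 ×ˢ Set.Ioo 0 h)
      ((Metric.ball (0 : Euc m) 1 ×ˢ Set.Ioo 0 h).indicator A) c₂ M := by
  have hS : MeasurableSet (Metric.ball (0 : Euc m) 1 ×ˢ Set.Ioo (0 : ℝ) h) :=
    measurableSet_ball.prod measurableSet_Ioo
  obtain ⟨M, hM⟩ := ((isCompact_closedBall (0 : Euc m) 1).prod
    (isCompact_Icc (a := (0 : ℝ)) (b := h))).exists_bound_of_continuousOn hA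
  refine ⟨M.toNNReal, H.continuous.measurable, hS,
    (Measure.map_mono Measure.restrict_le_self H.continuous.measurable).trans H.map_prod_le,
    ?_, fun z => ?_, fun z hz => Set.indicator_of_notMem hz _⟩
  · rw [aestronglyMeasurable_indicator_iff hS]
    exact (hA.mono (box_subset m h)).aestronglyMeasurable hS
  · by_cases hz : z ∈ Metric.ball (0 : Euc m) 1 ×ˢ Set.Ioo 0 h
    · rw [Set.indicator_of_mem hz]
      exact (hM z (box_subset m h hz)).trans (Real.le_coe_toNNReal M)
    · rw [Set.indicator_of_notMem hz, norm_zero]; exact NNReal.coe_nonneg _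

/-- Composition with `Ψ`, weighted by a continuous field of operators, as an operator on `L^p`. -/
theorem exists_compCLM [Fact (1 ≤ p)] (H : IsBallFibration Φ Ψ h c₁ c₂) (hp : p ≠ ⊤)
    {F F' : Type*} [NormedAddCommGroup F] [NormedSpace ℝ F] [NormedAddCommGroup F']
    [NormedSpace ℝ F'] {A : Euc m × ℝ → F →L[ℝ] F'}
    (hA : ContinuousOn A (Metric.closedBall (0 : Euc m) 1 ×ˢ Set.Icc 0 h)) :
    ∃ C : Lp F p (ballMeasure n) →L[ℝ]
        Lp F' p ((ballMeasure m).prod (volume.restrict (Set.Ioo 0 h))),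
      ∀ (f : Lp F p (ballMeasure n)) (g : Euc n → F), f =ᵐ[ballMeasure n] g →
        C f =ᵐ[(ballMeasure m).prod (volume.restrict (Set.Ioo 0 h))]
          fun z => A z (g (Ψ z)) := by
  obtain ⟨M, K⟩ := H.exists_isWeightedComp hA
  refine ⟨K.toCLM hp, fun f g hfg => ?_⟩
  filter_upwards [K.coeFn_toCLM hp f, K.congr_ae hfg, ae_mem_box m h] with z h1 h2 h3
  rw [h1, h2, Set.indicator_of_mem h3]

theorem continuousOn_fderiv (H : IsBallFibration Φ Ψ h c₁ c₂) :
    ContinuousOn (fderiv ℝ Ψ) (Metric.closedBall (0 : Euc m) 1 ×ˢ Set.Icc 0 h) := fun z hz =>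
  (((H.contDiffAt z hz).fderiv_right (m := 0) (by simp)).continuousAt).continuousWithinAt

theorem differentiableAt (H : IsBallFibration Φ Ψ h c₁ c₂) {z : Euc m × ℝ}
    (hz : z ∈ Metric.closedBall (0 : Euc m) 1 ×ˢ Set.Icc 0 h) : DifferentiableAt ℝ Ψ z :=
  (H.contDiffAt z hz).differentiableAt (by simp)

theorem hasDerivAt_comp_snd (H : IsBallFibration Φ Ψ h c₁ c₂) {g : Euc n → Euc ℓ}
    (hg : ContDiffOn ℝ 1 g (Metric.ball 0 1)) {x : Euc m} (hx : x ∈ Metric.closedBall (0 : Euc m) 1)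
    {t : ℝ} (ht : t ∈ Set.Icc 0 h) :
    HasDerivAt (fun t => g (Ψ (x, t))) (fderiv ℝ g (Ψ (x, t)) (fderiv ℝ Ψ (x, t) (0, 1))) t := by
  have hz : (x, t) ∈ Metric.closedBall (0 : Euc m) 1 ×ˢ Set.Icc 0 h := ⟨hx, ht⟩
  have h1 : HasFDerivAt g (fderiv ℝ g (Ψ (x, t))) (Ψ (x, t)) :=
    ((hg.differentiableOn one_ne_zero).differentiableAt
      (Metric.isOpen_ball.mem_nhds (H.mem_ball _ hz))).hasFDerivAt
  have h2 := h1.comp (x, t) (H.differentiableAt hz).hasFDerivAt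
  have h3 : HasDerivAt (fun t : ℝ => (x, t)) ((0 : Euc m), (1 : ℝ)) t :=
    (hasDerivAt_const t x).prodMk (hasDerivAt_id t)
  exact h2.comp_hasDerivAt t h3

theorem continuousOn_comp (H : IsBallFibration Φ Ψ h c₁ c₂) {E : Type*} [TopologicalSpace E]
    {g : Euc n → E} (hg : ContinuousOn g (Metric.ball 0 1)) :
    ContinuousOn (fun z => g (Ψ z)) (Metric.closedBall (0 : Euc m) 1 ×ˢ Set.Icc 0 h) :=
  hg.comp H.continuous.continuousOn H.mem_ball

/-- Integration by parts along the fibre direction expresses the value on a slice. -/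
theorem integral_slice (H : IsBallFibration Φ Ψ h c₁ c₂) {g : Euc n → Euc ℓ}
    (hg : ContDiffOn ℝ 1 g (Metric.ball 0 1)) {x : Euc m} (hx : x ∈ Metric.closedBall (0 : Euc m) 1)
    {τ : ℝ} (hτ : τ ∈ Set.Ioo 0 h) :
    ∫ t in Set.Ioo τ h, (g (Ψ (x, t))
      + (t - h) • fderiv ℝ g (Ψ (x, t)) (fderiv ℝ Ψ (x, t) (0, 1)))
      = (h - τ) • g (Ψ (x, τ)) := by
  have hsub : Set.Icc τ h ⊆ Set.Icc 0 h := Set.Icc_subset_Icc_left hτ.1.le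
  have hd := hg.continuousOn_fderiv_of_isOpen Metric.isOpen_ball le_rfl
  have hxt : Set.MapsTo (fun t : ℝ => (x, t)) (Set.Icc τ h)
      (Metric.closedBall (0 : Euc m) 1 ×ˢ Set.Icc 0 h) := fun t ht => ⟨hx, hsub ht⟩
  have hxc : ContinuousOn (fun t : ℝ => (x, t)) (Set.Icc τ h) := by fun_prop
  rw [← integral_Ioc_eq_integral_Ioo, ← intervalIntegral.integral_of_le hτ.2.le]
  have hder : ∀ t ∈ Set.uIcc τ h, HasDerivAt (fun t => (t - h) • g (Ψ (x, t)))
      (g (Ψ (x, t)) + (t - h) • fderiv ℝ g (Ψ (x, t)) (fderiv ℝ Ψ (x, t) (0, 1))) t := by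
    intro t ht
    rw [Set.uIcc_of_le hτ.2.le] at ht
    have := ((hasDerivAt_id t).sub_const h).smul (H.hasDerivAt_comp_snd hg hx (hsub ht))
    simp only [id, one_smul] at this
    rwa [add_comm] at this
  rw [intervalIntegral.integral_eq_sub_of_hasDerivAt hder]
  · rw [sub_self, zero_smul, zero_sub, ← neg_smul, neg_sub]
  · refine ContinuousOn.intervalIntegrable ?_
    rw [Set.uIcc_of_le hτ.2.le]
    have e1 := (H.continuousOn_comp hg.continuousOn).comp hxc hxt
    have e2 := (H.continuousOn_comp hd).comp hxc hxt
    have e3 := (H.continuousOn_fderiv.comp hxc hxt).clm_apply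
      (continuousOn_const (c := ((0 : Euc m), (1 : ℝ))))
    exact e1.add ((continuousOn_id.sub continuousOn_const).smul (e2.clm_apply e3))

theorem exists_clm_prod_smul_add {X Y Z F : Type*} [NormedAddCommGroup X] [NormedSpace ℝ X]
    [NormedAddCommGroup Y] [NormedSpace ℝ Y] [NormedAddCommGroup Z] [NormedSpace ℝ Z]
    [NormedAddCommGroup F] [NormedSpace ℝ F] (C₁ : X →L[ℝ] Z) (C₂ : Y →L[ℝ] Z)
    (I₁ I₂ : Z →L[ℝ] F) (r : ℝ) :
    ∃ Λ : X × Y →L[ℝ] F, ∀ a, Λ a = r • (I₁ (C₁ a.1) + I₂ (C₂ a.2)) :=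
  ⟨r • ((I₁.comp C₁).comp (.fst ℝ X Y) + (I₂.comp C₂).comp (.snd ℝ X Y)), fun _ => rfl⟩

set_option maxHeartbeats 1000000 in
theorem exists_slice_functional [Fact (1 ≤ p)] (H : IsBallFibration Φ Ψ h c₁ c₂) (hp : p ≠ ⊤)
    {η : Euc m → ℝ} (hη : IsBallTest η) {τ : ℝ} (hτ : τ ∈ Set.Ioo 0 h) :
    ∃ Λ : Lp (Euc ℓ) p (ballMeasure n) × Lp (Euc n →L[ℝ] Euc ℓ) p (ballMeasure n) →L[ℝ] Euc ℓ,
      ∀ (w : W1p n ℓ p) (g : Euc n → Euc ℓ), ContDiffOn ℝ 1 g (Metric.ball 0 1) →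
        reprFun w =ᵐ[ballMeasure n] g →
        Λ w.1 = ∫ x, η x • g (Ψ (x, τ)) ∂ballMeasure m := by
  set σ := (ballMeasure m).prod (volume.restrict (Set.Ioo 0 h)) with hσ
  obtain ⟨C, hC⟩ := hη.2.1.exists_bound_of_continuous hη.1.continuous
  have hC0 : 0 ≤ C := (norm_nonneg _).trans (hC 0)
  obtain ⟨C₁, hC₁⟩ := H.exists_compCLM hp (F := Euc ℓ) (F' := Euc ℓ)
    (A := fun _ => ContinuousLinearMap.id ℝ (Euc ℓ)) continuousOn_const
  obtain ⟨C₂, hC₂⟩ := H.exists_compCLM hp (F := Euc n →L[ℝ] Euc ℓ) (F' := Euc ℓ)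
    (A := fun z => ContinuousLinearMap.apply ℝ (Euc ℓ) (fderiv ℝ Ψ z (0, 1)))
    ((ContinuousLinearMap.continuous _).comp_continuousOn
      (H.continuousOn_fderiv.clm_apply continuousOn_const))
  have hSτ : MeasurableSet (Prod.snd ⁻¹' Set.Ioi τ : Set (Euc m × ℝ)) :=
    measurable_snd measurableSet_Ioi
  set k₁ : Euc m × ℝ → ℝ := (Prod.snd ⁻¹' Set.Ioi τ).indicator fun z => η z.1 with hk₁
  set k₂ : Euc m × ℝ → ℝ := (Prod.snd ⁻¹' Set.Ioi τ).indicator fun z => (z.2 - h) * η z.1 with hk₂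
  have m₁ : AEStronglyMeasurable k₁ σ :=
    (hη.1.continuous.comp continuous_fst).aestronglyMeasurable.indicator hSτ
  have m₂ : AEStronglyMeasurable k₂ σ :=
    ((continuous_snd.sub continuous_const).mul
      (hη.1.continuous.comp continuous_fst)).aestronglyMeasurable.indicator hSτ
  have b₁ : ∀ᵐ z ∂σ, ‖k₁ z‖ ≤ C := ae_of_all _ fun z =>
    (norm_indicator_le_norm_self _ _).trans (hC _)
  have b₂ : ∀ᵐ z ∂σ, ‖k₂ z‖ ≤ h * C := by
    filter_upwards [ae_mem_box m h] with z hz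
    refine (norm_indicator_le_norm_self _ _).trans ?_
    rw [norm_mul]
    refine mul_le_mul ?_ (hC _) (norm_nonneg _) H.pos.le
    rw [Real.norm_eq_abs, abs_le]
    constructor <;> linarith [hz.2.1, hz.2.2]
  obtain ⟨I₁, hI₁⟩ := exists_integral_smul_clm (F := Euc ℓ) (p := p) m₁ b₁
  obtain ⟨I₂, hI₂⟩ := exists_integral_smul_clm (F := Euc ℓ) (p := p) m₂ b₂
  obtain ⟨Λ, hΛ⟩ := exists_clm_prod_smul_add C₁ C₂ I₁ I₂ (h - τ)⁻¹
  refine ⟨Λ, fun w g hg hw => ?_⟩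
  have hdw := W1p.snd_ae_eq_fderiv w hg hw
  have e₁ := hC₁ _ _ hw
  have e₂ := hC₂ _ _ hdw
  have i₁ : Integrable (fun z => k₁ z • C₁ w.1.1 z) σ :=
    ((Lp.memLp (C₁ w.1.1)).integrable Fact.out).bdd_smul C m₁ b₁
  have i₂ : Integrable (fun z => k₂ z • C₂ w.1.2 z) σ :=
    ((Lp.memLp (C₂ w.1.2)).integrable Fact.out).bdd_smul (h * C) m₂ b₂
  set D : Euc m × ℝ → Euc ℓ := fun z => (Set.Ioi τ).indicator (fun t => η z.1 • (g (Ψ (z.1, t))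
      + (t - h) • fderiv ℝ g (Ψ (z.1, t)) (fderiv ℝ Ψ (z.1, t) (0, 1)))) z.2 with hD
  have e₃ : (fun z => k₁ z • C₁ w.1.1 z + k₂ z • C₂ w.1.2 z) =ᵐ[σ] D := by
    filter_upwards [e₁, e₂] with z h1 h2
    rw [h1, h2, hD, hk₁, hk₂]
    by_cases hz : z.2 ∈ Set.Ioi τ
    · rw [Set.indicator_of_mem (show z ∈ Prod.snd ⁻¹' Set.Ioi τ from hz),
        Set.indicator_of_mem (show z ∈ Prod.snd ⁻¹' Set.Ioi τ from hz)]
      simp only [Set.indicator_of_mem hz]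
      rw [smul_add, smul_smul, mul_comm (z.2 - h)]
      rfl
    · rw [Set.indicator_of_notMem (show z ∉ Prod.snd ⁻¹' Set.Ioi τ from hz),
        Set.indicator_of_notMem (show z ∉ Prod.snd ⁻¹' Set.Ioi τ from hz)]
      simp only [Set.indicator_of_notMem hz]
      simp
  have e₄ : ∫ z, D z ∂σ = ∫ x, (h - τ) • (η x • g (Ψ (x, τ))) ∂ballMeasure m := by
    rw [hσ, integral_prod _ ((i₁.add i₂).congr e₃)]
    refine setIntegral_congr_fun measurableSet_ball fun x hx => ?_
    simp only [hD]
    rw [setIntegral_indicator measurableSet_Ioi]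
    have : Set.Ioo 0 h ∩ Set.Ioi τ = Set.Ioo τ h := by
      ext t; constructor
      · rintro ⟨⟨_, h1⟩, h2⟩; exact ⟨h2, h1⟩
      · rintro ⟨h1, h2⟩; exact ⟨⟨hτ.1.trans h1, h2⟩, h1⟩
    rw [this, integral_smul, H.integral_slice hg (Metric.ball_subset_closedBall hx) hτ, smul_comm]
  have hne : h - τ ≠ 0 := (sub_pos.2 hτ.2).ne'
  rw [hΛ, hI₁, hI₂, ← integral_add i₁ i₂, integral_congr_ae e₃, e₄, integral_smul, smul_smul,
    inv_mul_cancel₀ hne, one_smul]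

end IsBallFibration

namespace IsBallFibration

variable {m n ℓ : ℕ} {Φ : Euc n → Euc m} {Ψ : Euc m × ℝ → Euc n} {h : ℝ} {c₁ c₂ : NNReal}
  {p : ℝ≥0∞}

/-- The slice functionals recover `w` from its pull-back by `Φ`. -/
theorem slice_functional_pull [Fact (1 ≤ p)] (H : IsBallFibration Φ Ψ h c₁ c₂) (hp : p ≠ ⊤)
    {η : Euc m → ℝ} (hη : IsBallTest η) {τ : ℝ} (hτ : τ ∈ Set.Ioo 0 h)
    {Λ : Lp (Euc ℓ) p (ballMeasure n) × Lp (Euc n →L[ℝ] Euc ℓ) p (ballMeasure n) →L[ℝ] Euc ℓ}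
    (hΛ : ∀ (w : W1p n ℓ p) (g : Euc n → Euc ℓ), ContDiffOn ℝ 1 g (Metric.ball 0 1) →
        reprFun w =ᵐ[ballMeasure n] g →
        Λ w.1 = ∫ x, η x • g (Ψ (x, τ)) ∂ballMeasure m)
    {w : W1p m ℓ p} (hw : w ∈ W1pZero m ℓ p) :
    Λ (H.pullFst hp ℓ w.1.1, H.pullSnd hp ℓ w.1.2) = ∫ x, η x • reprFun w x ∂ballMeasure m := by
  obtain ⟨I, hI⟩ := hη.exists_integral_smul_clm (F := Euc ℓ) (p := p)
  have hcont : Continuous fun w : W1p m ℓ p =>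
      Λ (H.pullFst hp ℓ w.1.1, H.pullSnd hp ℓ w.1.2) :=
    Λ.continuous.comp
      (((H.pullFst hp ℓ).continuous.comp (continuous_fst.comp continuous_subtype_val)).prodMk
      ((H.pullSnd hp ℓ).continuous.comp (continuous_snd.comp continuous_subtype_val)))
  have hcont' : Continuous fun w : W1p m ℓ p => I w.1.1 :=
    I.continuous.comp (continuous_fst.comp continuous_subtype_val)
  suffices hs : w ∈ {w : W1p m ℓ p |
      Λ (H.pullFst hp ℓ w.1.1, H.pullSnd hp ℓ w.1.2) = I w.1.1} by
    exact hs.trans (hI _)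
  refine closure_minimal ?_ (isClosed_eq hcont hcont') hw
  rintro w ⟨φ, hφ, hwφ⟩
  have ht := H.isBallTest_comp hφ
  have h1 := H.pullFst_test hp hφ hwφ
  have h2 := H.pullSnd_test hp hφ hwφ
  have hwd : IsWeakDerivOnBall (H.pullFst hp ℓ w.1.1) (H.pullSnd hp ℓ w.1.2) :=
    (isWeakDerivOnBall_fderiv (ht.1.of_le (by simp)).contDiffOn).congr_ae h1.symm h2.symm
  rw [Set.mem_ofPred_eq, hI]
  refine (hΛ ⟨(H.pullFst hp ℓ w.1.1, H.pullSnd hp ℓ w.1.2), hwd⟩ (φ ∘ Φ)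
    (ht.1.of_le (by simp)).contDiffOn h1).trans ?_
  refine integral_congr_ae ?_
  filter_upwards [hwφ, ae_restrict_mem measurableSet_ball] with x h3 h4
  have h3' : (w.1.1 : Euc m → Euc ℓ) x = φ x := h3
  rw [h3', Function.comp_apply,
    H.right_inv (x, τ) ⟨Metric.ball_subset_closedBall h4, Set.Ioo_subset_Icc_self hτ⟩]

theorem contDiffOn_slice (H : IsBallFibration Φ Ψ h c₁ c₂) {g : Euc n → Euc ℓ}
    (hg : ContDiffOn ℝ ∞ g (Metric.closedBall 0 1)) {τ : ℝ} (hτ : τ ∈ Set.Icc 0 h) :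
    ContDiffOn ℝ ∞ (fun x => g (Ψ (x, τ))) (Metric.closedBall 0 1) := by
  intro x hx
  have h1 : ContDiffAt ℝ ∞ g (Ψ (x, τ)) :=
    (hg.contDiffAt (mem_of_superset (Metric.isOpen_ball.mem_nhds (H.mem_ball (x, τ) ⟨hx, hτ⟩))
      Metric.ball_subset_closedBall))
  exact ((h1.comp (x, τ) (H.contDiffAt _ ⟨hx, hτ⟩)).comp x
    (contDiffAt_id.prodMk contDiffAt_const)).contDiffWithinAt

theorem fderiv_slice (H : IsBallFibration Φ Ψ h c₁ c₂) {g : Euc n → Euc ℓ}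
    (hg : ContDiffOn ℝ 1 g (Metric.ball 0 1)) {x : Euc m} (hx : x ∈ Metric.closedBall (0 : Euc m) 1)
    {t : ℝ} (ht : t ∈ Set.Icc 0 h) :
    fderiv ℝ (fun x => g (Ψ (x, t))) x
      = (fderiv ℝ g (Ψ (x, t))).comp ((fderiv ℝ Ψ (x, t)).comp (.inl ℝ (Euc m) ℝ)) := by
  have hz : (x, t) ∈ Metric.closedBall (0 : Euc m) 1 ×ˢ Set.Icc 0 h := ⟨hx, ht⟩
  have h1 : HasFDerivAt g (fderiv ℝ g (Ψ (x, t))) (Ψ (x, t)) :=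
    ((hg.differentiableOn one_ne_zero).differentiableAt
      (Metric.isOpen_ball.mem_nhds (H.mem_ball _ hz))).hasFDerivAt
  have h2 : HasFDerivAt (fun x => Ψ (x, t)) ((fderiv ℝ Ψ (x, t)).comp (.inl ℝ (Euc m) ℝ)) x :=
    HasFDerivAt.comp (f := fun x => (x, t)) x (H.differentiableAt hz).hasFDerivAt
      (hasFDerivAt_prodMk_left x t)
  exact (HasFDerivAt.comp (f := fun x => Ψ (x, t)) x h1 h2).fderiv

/-- The operator sending `(f, G)` to the slicewise function and derivative. -/
theorem exists_slice_energy [Fact (1 ≤ p)] (H : IsBallFibration Φ Ψ h c₁ c₂) (hp : p ≠ ⊤) (ℓ : ℕ) :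
    ∃ (C₁ : Lp (Euc ℓ) p (ballMeasure n) →L[ℝ]
        Lp (Euc ℓ) p ((ballMeasure m).prod (volume.restrict (Set.Ioo 0 h))))
      (C₂ : Lp (Euc n →L[ℝ] Euc ℓ) p (ballMeasure n) →L[ℝ]
        Lp (Euc m →L[ℝ] Euc ℓ) p ((ballMeasure m).prod (volume.restrict (Set.Ioo 0 h)))),
      ∀ (w : W1p n ℓ p) (g : Euc n → Euc ℓ), ContDiffOn ℝ 1 g (Metric.ball 0 1) →
        reprFun w =ᵐ[ballMeasure n] g →
        (C₁ w.1.1 =ᵐ[(ballMeasure m).prod (volume.restrict (Set.Ioo 0 h))] fun z => g (Ψ z)) ∧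
        (C₂ w.1.2 =ᵐ[(ballMeasure m).prod (volume.restrict (Set.Ioo 0 h))]
          fun z => fderiv ℝ (fun x => g (Ψ (x, z.2))) z.1) := by
  obtain ⟨C₁, hC₁⟩ := H.exists_compCLM hp (F := Euc ℓ) (F' := Euc ℓ)
    (A := fun _ => ContinuousLinearMap.id ℝ (Euc ℓ)) continuousOn_const
  obtain ⟨C₂, hC₂⟩ := H.exists_compCLM hp (F := Euc n →L[ℝ] Euc ℓ) (F' := Euc m →L[ℝ] Euc ℓ)
    (A := fun z => (ContinuousLinearMap.compL ℝ (Euc m) (Euc n) (Euc ℓ)).flip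
      ((fderiv ℝ Ψ z).comp (.inl ℝ (Euc m) ℝ)))
    ((ContinuousLinearMap.continuous _).comp_continuousOn
      (H.continuousOn_fderiv.clm_comp continuousOn_const))
  refine ⟨C₁, C₂, fun w g hg hw => ⟨hC₁ _ _ hw, ?_⟩⟩
  filter_upwards [hC₂ _ _ (W1p.snd_ae_eq_fderiv w hg hw), ae_mem_box m h] with z h1 h2
  rw [h1, H.fderiv_slice hg (Metric.ball_subset_closedBall h2.1) (Set.Ioo_subset_Icc_self h2.2)]
  rfl

end IsBallFibration

/-- If the energies of a sequence on a product are bounded, then some slice has bounded energy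
along a subsequence. -/
theorem exists_slice_frequently_le {α β : Type*} [MeasurableSpace α] [MeasurableSpace β]
    {μ : Measure α} {ν : Measure β} [SFinite μ] [SFinite ν] (hν : ν ≠ 0) {P : β → Prop}
    (hP : ∀ᵐ t ∂ν, P t) {e : ℕ → α × β → ℝ≥0∞} (he : ∀ k, AEMeasurable (e k) (μ.prod ν))
    {R : ℝ≥0∞} (hR : R ≠ ⊤) (hb : ∀ k, ∫⁻ z, e k z ∂μ.prod ν ≤ R) :
    ∃ t, P t ∧ ∃ R' : ℝ≥0∞, R' ≠ ⊤ ∧ ∃ᶠ k in atTop, ∫⁻ x, e k (x, t) ∂μ ≤ R' := by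
  have h1 : ∀ k, AEMeasurable (fun t => ∫⁻ x, e k (x, t) ∂μ) ν := fun k =>
    (he k).prod_swap.lintegral_prod_right'
  have h2 : ∫⁻ t, liminf (fun k => ∫⁻ x, e k (x, t) ∂μ) atTop ∂ν ≤ R := by
    refine (lintegral_liminf_le' h1).trans ?_
    refine liminf_le_of_frequently_le' (Frequently.of_forall fun k => ?_)
    rw [← lintegral_prod_symm _ (he k)]
    exact hb k
  have h4 : AEMeasurable (fun t => liminf (fun k => ∫⁻ x, e k (x, t) ∂μ) atTop) ν := by
    simp_rw [liminf_eq_iSup_iInf_of_nat]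
    exact .iSup fun n => .biInf _ (Set.to_countable _) fun k _ => h1 k
  have h3 := ae_lt_top' h4 (ne_top_of_le_ne_top hR h2)
  have : NeZero ν := ⟨hν⟩
  obtain ⟨t, ht, hPt⟩ := (h3.and hP).exists
  obtain ⟨R', hR1, hR2⟩ := ENNReal.lt_iff_exists_nnreal_btwn.1 ht
  refine ⟨t, hPt, R', ENNReal.coe_ne_top, ?_⟩
  exact (frequently_lt_of_liminf_lt (by isBoundedDefault) hR1).mono fun k hk => hk.le

theorem lintegral_rpow_enorm_eq_eLpNorm_rpow {α F : Type*} [MeasurableSpace α] {μ : Measure α}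
    [NormedAddCommGroup F] {p : ℝ≥0∞} (hp0 : p ≠ 0) (hp : p ≠ ⊤) (f : α → F) :
    ∫⁻ x, ‖f x‖ₑ ^ p.toReal ∂μ = eLpNorm f p μ ^ p.toReal := by
  have hP := ENNReal.toReal_pos hp0 hp
  rw [eLpNorm_eq_lintegral_rpow_enorm_toReal hp0 hp, ← ENNReal.rpow_mul, one_div,
    inv_mul_cancel₀ hP.ne', ENNReal.rpow_one]

theorem norm_toLp_le_of_lintegral_le {α F : Type*} [MeasurableSpace α] {μ : Measure α}
    [NormedAddCommGroup F] {p : ℝ≥0∞} (hp0 : p ≠ 0) (hp : p ≠ ⊤) {f : α → F} (hf : MemLp f p μ)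
    {R : ℝ≥0∞} (hR : R ≠ ⊤) (h : ∫⁻ x, ‖f x‖ₑ ^ p.toReal ∂μ ≤ R) :
    ‖hf.toLp‖ ≤ (R ^ (p.toReal)⁻¹).toReal := by
  have hP := ENNReal.toReal_pos hp0 hp
  rw [lintegral_rpow_enorm_eq_eLpNorm_rpow hp0 hp] at h
  rw [Lp.norm_toLp]
  refine ENNReal.toReal_mono (ENNReal.rpow_ne_top_of_nonneg (by positivity) hR) ?_
  exact (ENNReal.le_rpow_inv_iff hP).2 h

theorem memLp_of_lintegral_le {α F : Type*} [MeasurableSpace α] {μ : Measure α}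
    [NormedAddCommGroup F] {p : ℝ≥0∞} (hp0 : p ≠ 0) (hp : p ≠ ⊤) {f : α → F}
    (hf : AEStronglyMeasurable f μ)
    {R : ℝ≥0∞} (hR : R ≠ ⊤) (h : ∫⁻ x, ‖f x‖ₑ ^ p.toReal ∂μ ≤ R) : MemLp f p μ := by
  have hP := ENNReal.toReal_pos hp0 hp
  rw [lintegral_rpow_enorm_eq_eLpNorm_rpow hp0 hp] at h
  exact ⟨hf, ((ENNReal.le_rpow_inv_iff hP).2 h).trans_lt
    (ENNReal.rpow_ne_top_of_nonneg (by positivity) hR).lt_top⟩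

theorem lintegral_rpow_enorm_Lp_le {α F : Type*} [MeasurableSpace α] {μ : Measure α}
    [NormedAddCommGroup F] {p : ℝ≥0∞} [Fact (1 ≤ p)] (hp0 : p ≠ 0) (hp : p ≠ ⊤) {f : Lp F p μ} {K : ℝ}
    (hK : ‖f‖ ≤ K) : ∫⁻ x, ‖f x‖ₑ ^ p.toReal ∂μ ≤ ENNReal.ofReal K ^ p.toReal := by
  rw [lintegral_rpow_enorm_eq_eLpNorm_rpow hp0 hp]
  refine ENNReal.rpow_le_rpow ?_ ENNReal.toReal_nonneg
  rw [ENNReal.le_ofReal_iff_toReal_le (Lp.memLp f).2.ne ((norm_nonneg f).trans hK), ← Lp.norm_def]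
  exact hK

/-- For a sequence of `W^{1,p}` functions with smooth representatives that is bounded in norm,
some slice is bounded in `W^{1,p}` along a subsequence. -/
theorem IsBallFibration.exists_bounded_slices {m n ℓ : ℕ} {Φ : Euc n → Euc m}
    {Ψ : Euc m × ℝ → Euc n} {h : ℝ} {c₁ c₂ : NNReal} {p : ℝ≥0∞} [Fact (1 ≤ p)]
    (H : IsBallFibration Φ Ψ h c₁ c₂) (hp : p ≠ ⊤) {W : ℕ → W1p n ℓ p} {K : ℝ}
    (hK : ∀ k, ‖W k‖ ≤ K) {g : ℕ → Euc n → Euc ℓ}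
    (hg : ∀ k, ContDiffOn ℝ ∞ (g k) (Metric.closedBall 0 1))
    (hW : ∀ k, reprFun (W k) =ᵐ[ballMeasure n] g k) :
    ∃ τ ∈ Set.Ioo 0 h, ∃ (φ : ℕ → ℕ) (K' : ℝ) (U : ℕ → W1p m ℓ p), StrictMono φ ∧
      (∀ k, ‖U k‖ ≤ K') ∧
      ∀ k, reprFun (U k) =ᵐ[ballMeasure m] fun x => g (φ k) (Ψ (x, τ)) := by
  have hp0 : p ≠ 0 := (zero_lt_one.trans_le (Fact.out : 1 ≤ p)).ne'
  have hgb : ∀ k, ContDiffOn ℝ 1 (g k) (Metric.ball 0 1) := fun k =>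
    ((hg k).of_le (by simp)).mono Metric.ball_subset_closedBall
  obtain ⟨C₁, C₂, hC⟩ := H.exists_slice_energy hp ℓ
  set P := p.toReal with hP
  set e : ℕ → Euc m × ℝ → ℝ≥0∞ := fun k z => ‖g k (Ψ z)‖ₑ ^ P
    + ‖fderiv ℝ (fun x => g k (Ψ (x, z.2))) z.1‖ₑ ^ P with he
  have hee : ∀ k, (fun z => ‖C₁ (W k).1.1 z‖ₑ ^ P + ‖C₂ (W k).1.2 z‖ₑ ^ P)
      =ᵐ[(ballMeasure m).prod (volume.restrict (Set.Ioo 0 h))] e k := by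
    intro k
    filter_upwards [(hC (W k) (g k) (hgb k) (hW k)).1, (hC (W k) (g k) (hgb k) (hW k)).2]
      with z h1 h2
    rw [h1, h2]
  have hm₁ : ∀ k, AEMeasurable (fun z => ‖C₁ (W k).1.1 z‖ₑ ^ P)
      ((ballMeasure m).prod (volume.restrict (Set.Ioo 0 h))) := fun k =>
    (Lp.aestronglyMeasurable (C₁ (W k).1.1)).enorm.pow_const P
  have hm₂ : ∀ k, AEMeasurable (fun z => ‖C₂ (W k).1.2 z‖ₑ ^ P)
      ((ballMeasure m).prod (volume.restrict (Set.Ioo 0 h))) := fun k =>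
    (Lp.aestronglyMeasurable (C₂ (W k).1.2)).enorm.pow_const P
  have hb : ∀ k, ∫⁻ z, e k z ∂(ballMeasure m).prod (volume.restrict (Set.Ioo 0 h))
      ≤ ENNReal.ofReal (‖C₁‖ * K) ^ P + ENNReal.ofReal (‖C₂‖ * K) ^ P := by
    intro k
    rw [← lintegral_congr_ae (hee k), lintegral_add_left' (hm₁ k)]
    refine add_le_add (lintegral_rpow_enorm_Lp_le hp0 hp ?_) (lintegral_rpow_enorm_Lp_le hp0 hp ?_)
    · exact (C₁.le_opNorm _).trans (mul_le_mul_of_nonneg_left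
        ((norm_fst_le (W k).1).trans (hK k)) (norm_nonneg _))
    · exact (C₂.le_opNorm _).trans (mul_le_mul_of_nonneg_left
        ((norm_snd_le (W k).1).trans (hK k)) (norm_nonneg _))
  have hν : (volume.restrict (Set.Ioo 0 h) : Measure ℝ) ≠ 0 := by
    rw [Ne, Measure.restrict_eq_zero, Real.volume_Ioo, sub_zero, ENNReal.ofReal_eq_zero, not_le]
    exact H.pos
  obtain ⟨τ, hτ, R, hR, hfr⟩ := exists_slice_frequently_le hν
    (ae_restrict_mem measurableSet_Ioo)
    (fun k => ((hm₁ k).add (hm₂ k)).congr (hee k))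
    (ENNReal.add_ne_top.2 ⟨ENNReal.rpow_ne_top_of_nonneg ENNReal.toReal_nonneg ENNReal.ofReal_ne_top,
      ENNReal.rpow_ne_top_of_nonneg ENNReal.toReal_nonneg ENNReal.ofReal_ne_top⟩) hb
  obtain ⟨φ, hφ, hφR⟩ := extraction_of_frequently_atTop hfr
  have hs : ∀ k, ContDiffOn ℝ 1 (fun x => g (φ k) (Ψ (x, τ))) (Metric.ball 0 1) := fun k =>
    ((H.contDiffOn_slice (hg (φ k)) (Set.Ioo_subset_Icc_self hτ)).of_le (by simp)).mono
      Metric.ball_subset_closedBall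
  have b₁ : ∀ k, ∫⁻ x, ‖g (φ k) (Ψ (x, τ))‖ₑ ^ P ∂ballMeasure m ≤ R := fun k =>
    (lintegral_mono fun x => le_self_add).trans (hφR k)
  have b₂ : ∀ k, ∫⁻ x, ‖fderiv ℝ (fun x => g (φ k) (Ψ (x, τ))) x‖ₑ ^ P ∂ballMeasure m ≤ R :=
    fun k => (lintegral_mono fun x => le_add_self).trans (hφR k)
  have m₁ : ∀ k, MemLp (fun x => g (φ k) (Ψ (x, τ))) p (ballMeasure m) := fun k =>
    memLp_of_lintegral_le hp0 hp ((hs k).continuousOn.aestronglyMeasurable measurableSet_ball)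
      hR (b₁ k)
  have m₂ : ∀ k, MemLp (fderiv ℝ fun x => g (φ k) (Ψ (x, τ))) p (ballMeasure m) := fun k =>
    memLp_of_lintegral_le hp0 hp (((hs k).continuousOn_fderiv_of_isOpen Metric.isOpen_ball
      le_rfl).aestronglyMeasurable measurableSet_ball) hR (b₂ k)
  refine ⟨τ, hτ, φ, (R ^ P⁻¹).toReal,
    fun k => W1p.of (m₁ k) (m₂ k) (isWeakDerivOnBall_fderiv (hs k)), hφ, fun k => ?_,
    fun k => (m₁ k).coeFn_toLp⟩
  exact max_le (norm_toLp_le_of_lintegral_le hp0 hp (m₁ k) hR (b₁ k))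
    (norm_toLp_le_of_lintegral_le hp0 hp (m₂ k) hR (b₂ k))

theorem IsBallFibration.isWeakLimitOfSmooth_of_pull {m n ℓ : ℕ} {Φ : Euc n → Euc m}
    {Ψ : Euc m × ℝ → Euc n} {h : ℝ} {c₁ c₂ : NNReal} {p : ℝ≥0∞} [Fact (1 ≤ p)]
    (H : IsBallFibration Φ Ψ h c₁ c₂) (hp1 : 1 < p) (hp : p ≠ ⊤) {N : Set (Euc ℓ)}
    {u w : W1p m ℓ p} {c : Euc ℓ} (hw : w ∈ W1pZero m ℓ p)
    (huw : reprFun u =ᵐ[ballMeasure m] fun x => c + reprFun w x) {w' : W1p n ℓ p}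
    (hw' : w'.1 = (H.pullFst hp ℓ w.1.1, H.pullSnd hp ℓ w.1.2))
    (hv : IsWeakLimitOfSmooth N (W1p.const n p c + w')) : IsWeakLimitOfSmooth N u := by
  obtain ⟨W, hW, hlim⟩ := hv
  choose g hg hgN hgW using hW
  obtain ⟨K, hK⟩ := exists_norm_le_of_tendsto_toWeakSpace hlim
  obtain ⟨τ, hτ, φ, K', U, hφ, hU, hUg⟩ := H.exists_bounded_slices hp hK hg hgW
  have hτ' := Set.Ioo_subset_Icc_self hτ
  refine ⟨U, fun k => ⟨_, H.contDiffOn_slice (hg (φ k)) hτ', fun x hx => ?_, hUg k⟩, ?_⟩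
  · exact hgN _ _ (Metric.ball_subset_closedBall (H.mem_ball (x, τ) ⟨hx, hτ'⟩))
  refine W1p.tendsto_toWeakSpace hp1 hp hU fun η hη => ?_
  obtain ⟨Λ, hΛ⟩ := H.exists_slice_functional (ℓ := ℓ) hp hη hτ
  have h1 := (tendsto_of_tendsto_toWeakSpace hlim (Λ.comp (W1p n ℓ p).subtypeL)).comp
    hφ.tendsto_atTop
  have h2 : ∀ k, ∫ x, η x • reprFun (U k) x ∂ballMeasure m = Λ (W (φ k)).1 := by
    intro k
    rw [hΛ _ _ (((hg (φ k)).of_le (by simp)).mono Metric.ball_subset_closedBall) (hgW (φ k))]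
    refine integral_congr_ae ?_
    filter_upwards [hUg k] with x hx
    rw [hx]
  obtain ⟨I, hI⟩ := hη.exists_integral_smul_clm (F := Euc ℓ) (p := p)
  have h3 : Λ (W1p.const n p c + w').1 = ∫ x, η x • reprFun u x ∂ballMeasure m := by
    have e1 : Λ (W1p.const n p c).1 = ∫ x, η x • reprFun (W1p.const m p c) x ∂ballMeasure m := by
      rw [hΛ _ (fun _ => c) contDiffOn_const (W1p.reprFun_const n p c)]
      refine integral_congr_ae ?_
      filter_upwards [W1p.reprFun_const m p c] with x hx
      rw [hx]
    have e2 := H.slice_functional_pull hp hη hτ hΛ hw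
    have e3 : (∫ x, η x • reprFun (W1p.const m p c) x ∂ballMeasure m)
        + ∫ x, η x • reprFun w x ∂ballMeasure m = ∫ x, η x • reprFun u x ∂ballMeasure m := by
      simp only [reprFun]
      rw [← hI, ← hI, ← map_add, hI]
      refine integral_congr_ae ?_
      filter_upwards [Lp.coeFn_add (W1p.const m p c).1.1 w.1.1, huw, W1p.reprFun_const m p c]
        with x h1 h2 h3
      simp only [reprFun] at h2 h3
      rw [h1, h2, Pi.add_apply, h3]
    rw [← e3, ← e1, ← e2, ← hw', ← map_add]
    rfl
  rw [← h3]
  exact h1.congr fun k => (h2 k).symm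

/-- Non-approximability is inherited through ball fibrations. -/
theorem IsBallFibration.exists_not_isWeakLimitOfSmooth {m n ℓ : ℕ} {Φ : Euc n → Euc m}
    {Ψ : Euc m × ℝ → Euc n} {h : ℝ} {c₁ c₂ : NNReal} {p : ℝ≥0∞} [Fact (1 ≤ p)]
    (H : IsBallFibration Φ Ψ h c₁ c₂) (hp1 : 1 < p) (hp : p ≠ ⊤) {N : Set (Euc ℓ)}
    (hu : ∃ u ∈ W1pConst m p N, ¬ IsWeakLimitOfSmooth N u) :
    ∃ v ∈ W1pConst n p N, ¬ IsWeakLimitOfSmooth N v := by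
  obtain ⟨u, ⟨huN, c, hc, w, hw, huw⟩, hnot⟩ := hu
  obtain ⟨w', hw'0, hw'⟩ := H.exists_pull_mem_W1pZero hp hw
  exact ⟨W1p.const n p c + w',
    H.add_pull_mem_W1pConst hp huN hc huw hw'0 (congrArg Prod.fst hw'),
    fun hv => hnot (H.isWeakLimitOfSmooth_of_pull hp1 hp hw huw hw' hv)⟩

section Geometry

/-- `C^1` maps between spaces of the same dimension increase Haar measures at most by a constant
factor on compact convex sets. -/
theorem exists_measure_image_le {E F : Type*} [NormedAddCommGroup E] [NormedSpace ℝ E]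
    [FiniteDimensional ℝ E] [MeasurableSpace E] [BorelSpace E] [NormedAddCommGroup F]
    [NormedSpace ℝ F] [FiniteDimensional ℝ F] [MeasurableSpace F] [BorelSpace F]
    (μ : Measure E) [μ.IsAddHaarMeasure] (ν : Measure F) [ν.IsAddHaarMeasure]
    (hd : Module.finrank ℝ E = Module.finrank ℝ F) {f : E → F} {K : Set E} (hK : IsCompact K)
    (hconv : Convex ℝ K) (hf : ∀ x ∈ K, ContDiffAt ℝ 1 f x) :
    ∃ c : NNReal, ∀ s ⊆ K, ν (f '' s) ≤ c * μ s := by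
  have hc : ContinuousOn (fderiv ℝ f) K := fun x hx =>
    ((hf x hx).fderiv_right (m := 0) (by simp)).continuousAt.continuousWithinAt
  obtain ⟨C, hC⟩ := hK.exists_bound_of_continuousOn hc
  have hL : LipschitzOnWith C.toNNReal f K := by
    refine hconv.lipschitzOnWith_of_nnnorm_fderiv_le (𝕜 := ℝ)
      (fun x hx => (hf x hx).differentiableAt (by simp)) fun x hx => ?_
    rw [← NNReal.coe_le_coe, coe_nnnorm]
    exact (hC x hx).trans (Real.le_coe_toNNReal C)
  set d := Module.finrank ℝ E with hdd
  set μE : Measure E := μH[(d : ℝ)] with hμE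
  set μF : Measure F := μH[(d : ℝ)] with hμF
  have : μE.IsAddHaarMeasure := isAddHaarMeasure_hausdorffMeasure
  have : μF.IsAddHaarMeasure := by rw [hμF, hd]; exact isAddHaarMeasure_hausdorffMeasure
  set a := Measure.addHaarScalarFactor ν μF
  set b := Measure.addHaarScalarFactor μE μ
  have h1 : ν = a • μF := Measure.isAddLeftInvariant_eq_smul ν μF
  have h2 : μE = b • μ := Measure.isAddLeftInvariant_eq_smul μE μ
  refine ⟨a * (C.toNNReal ^ d * b), fun s hs => ?_⟩
  have h3 : μF (f '' s) ≤ (C.toNNReal : ℝ≥0∞) ^ (d : ℝ) * μE s :=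
    (hL.mono hs).hausdorffMeasure_image_le (Nat.cast_nonneg d)
  rw [h1, Measure.smul_apply, ENNReal.smul_def, smul_eq_mul]
  rw [ENNReal.rpow_natCast, h2, Measure.smul_apply, ENNReal.smul_def, smul_eq_mul] at h3
  calc (a : ℝ≥0∞) * μF (f '' s) ≤ a * ((C.toNNReal : ℝ≥0∞) ^ d * (b * μ s)) := by gcongr
    _ = ((a * (C.toNNReal ^ d * b) : NNReal) : ℝ≥0∞) * μ s := by push_cast; ring

variable {m n : ℕ} {Φ : Euc n → Euc m} {Ψ : Euc m × ℝ → Euc n} {h : ℝ}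

theorem exists_map_le_of_leftInverse (hm : n = m + 1) (hΨ : Continuous Ψ)
    (hball : ∀ z ∈ Metric.closedBall (0 : Euc m) 1 ×ˢ Set.Icc 0 h, Ψ z ∈ Metric.ball 0 1)
    {Θ : Euc n → Euc m × ℝ} (hΘ : ContDiff ℝ 1 Θ)
    (hinv : ∀ z ∈ Metric.closedBall (0 : Euc m) 1 ×ˢ Set.Icc 0 h, Θ (Ψ z) = z) :
    ∃ c : NNReal, ((ballMeasure m).prod (volume.restrict (Set.Ioo 0 h))).map Ψ
      ≤ c • ballMeasure n := by
  obtain ⟨c, hc⟩ := exists_measure_image_le (volume : Measure (Euc n))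
    ((volume : Measure (Euc m)).prod (volume : Measure ℝ)) (by simp [hm])
    (isCompact_closedBall (0 : Euc n) 1) (convex_closedBall _ _) fun x _ => hΘ.contDiffAt (x := x)
  refine ⟨c, Measure.le_iff.2 fun A hA => ?_⟩
  rw [Measure.map_apply hΨ.measurable hA, Measure.prod_restrict,
    Measure.restrict_apply (hΨ.measurable hA), Measure.smul_apply, Measure.restrict_apply hA,
    ENNReal.smul_def, smul_eq_mul]
  refine (measure_mono ?_).trans (hc (A ∩ Metric.ball 0 1)
    (Set.inter_subset_right.trans Metric.ball_subset_closedBall))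
  rintro z ⟨hzA, hz⟩
  have hz' := IsBallFibration.box_subset m h hz
  exact ⟨Ψ z, ⟨hzA, hball z hz'⟩, hinv z hz'⟩

theorem exists_map_le_of_cover (hm : n = m + 1) (hΦ : Continuous Φ) {ι : Type*} [Fintype ι]
    {Ψ : ι → Euc m × ℝ → Euc n}
    (hΨ : ∀ i, ∀ z ∈ Metric.closedBall (0 : Euc m) 1 ×ˢ Set.Icc (-h) h, ContDiffAt ℝ 1 (Ψ i) z)
    (hcov : ∀ y, Φ y ∈ Metric.ball 0 1 → ∃ i, ∃ t ∈ Set.Icc (-h) h, Ψ i (Φ y, t) = y) :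
    ∃ c : NNReal, ((ballMeasure n).restrict (Φ ⁻¹' Metric.ball 0 1)).map Φ
      ≤ c • ballMeasure m := by
  have hK : IsCompact (Metric.closedBall (0 : Euc m) 1 ×ˢ Set.Icc (-h) h) :=
    (isCompact_closedBall _ _).prod isCompact_Icc
  choose c hc using fun i => exists_measure_image_le
    ((volume : Measure (Euc m)).prod (volume : Measure ℝ)) (volume : Measure (Euc n))
    (by simp [hm]) hK ((convex_closedBall _ _).prod (convex_Icc _ _)) (hΨ i)
  refine ⟨(∑ i, c i) * (2 * h).toNNReal, Measure.le_iff.2 fun A hA => ?_⟩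
  have hS := hΦ.measurable (measurableSet_ball (x := (0 : Euc m)) (ε := 1))
  rw [Measure.map_apply hΦ.measurable hA, Measure.restrict_apply (hΦ.measurable hA),
    Measure.smul_apply, Measure.restrict_apply hA, ENNReal.smul_def, smul_eq_mul]
  set B := A ∩ Metric.ball (0 : Euc m) 1
  have hsub : Φ ⁻¹' A ∩ Φ ⁻¹' Metric.ball 0 1 ⊆ ⋃ i, Ψ i '' (B ×ˢ Set.Icc (-h) h) := by
    rintro y ⟨h1, h2⟩
    obtain ⟨i, t, ht, hy⟩ := hcov y h2
    exact Set.mem_iUnion.2 ⟨i, (Φ y, t), ⟨⟨h1, h2⟩, ht⟩, hy⟩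
  calc ballMeasure n (Φ ⁻¹' A ∩ Φ ⁻¹' Metric.ball 0 1)
      ≤ volume (Φ ⁻¹' A ∩ Φ ⁻¹' Metric.ball 0 1) := Measure.restrict_le_self _
    _ ≤ volume (⋃ i, Ψ i '' (B ×ˢ Set.Icc (-h) h)) := measure_mono hsub
    _ ≤ ∑ i, volume (Ψ i '' (B ×ˢ Set.Icc (-h) h)) := measure_iUnion_fintype_le _ _
    _ ≤ ∑ i, c i * (volume B * ENNReal.ofReal (2 * h)) := by
      refine Finset.sum_le_sum fun i _ => ?_
      refine (hc i _ (Set.prod_mono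
        (Set.inter_subset_right.trans Metric.ball_subset_closedBall) subset_rfl)).trans ?_
      rw [Measure.prod_prod, Real.volume_Icc]
      gcongr
      linarith
    _ = (((∑ i, c i) * (2 * h).toNNReal : NNReal) : ℝ≥0∞) * volume B := by
      rw [← Finset.sum_mul, ENNReal.ofReal]
      push_cast
      ring

end Geometry

section Rotation

variable {k : ℕ}

/-- The point of `ℝ^{k+2}` with coordinates `(a, b, z)`. -/
noncomputable def eucCons₂ (a b : ℝ) (z : Fin k → ℝ) : Euc (k + 2) :=
  WithLp.toLp 2 (Fin.cons a (Fin.cons b z : Fin (k + 1) → ℝ) : Fin (k + 2) → ℝ)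

/-- The map `(y₀, y₁, z) ↦ (16 (y₀² + y₁² - 1/2), 16 z)`, whose fibres are circles. -/
noncomputable def ringProj (k : ℕ) (y : Euc (k + 2)) : Euc (k + 1) :=
  WithLp.toLp 2 (Fin.cons (16 * (y 0 ^ 2 + y 1 ^ 2 - 1 / 2))
    (fun i : Fin k => 16 * y i.succ.succ) : Fin (k + 1) → ℝ)

/-- The radial coordinate of a local section of `ringProj`. -/
noncomputable def ringRoot (z : Euc (k + 1) × ℝ) : ℝ := √(1 / 2 + z.1 0 / 16 - z.2 ^ 2)

/-- The local trivialisation of `ringProj` over which the first coordinate is positive. -/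
noncomputable def ringSect (k : ℕ) (z : Euc (k + 1) × ℝ) : Euc (k + 2) :=
  eucCons₂ (ringRoot z) z.2 fun i => z.1 i.succ / 16

theorem norm_sq_eucCons₂ (a b : ℝ) (z : Fin k → ℝ) :
    ‖eucCons₂ a b z‖ ^ 2 = a ^ 2 + b ^ 2 + ∑ i, z i ^ 2 := by
  rw [EuclideanSpace.norm_sq_eq, Fin.sum_univ_succ, Fin.sum_univ_succ]
  simp [eucCons₂, add_assoc]

theorem norm_sq_ringProj (y : Euc (k + 2)) : ‖ringProj k y‖ ^ 2
    = (16 * (y 0 ^ 2 + y 1 ^ 2 - 1 / 2)) ^ 2 + ∑ i : Fin k, (16 * y i.succ.succ) ^ 2 := by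
  rw [EuclideanSpace.norm_sq_eq, Fin.sum_univ_succ]
  simp [ringProj, mul_pow]

theorem norm_sq_succ {n : ℕ} (x : Euc (n + 1)) : ‖x‖ ^ 2 = x 0 ^ 2 + ∑ i : Fin n, x i.succ ^ 2 := by
  rw [EuclideanSpace.norm_sq_eq, Fin.sum_univ_succ]
  simp

theorem contDiff_ringProj : ContDiff ℝ ∞ (ringProj k) := by
  rw [contDiff_euclidean]
  intro i
  refine Fin.cases ?_ (fun j => ?_) i
  · simp only [ringProj, Fin.cons_zero]
    fun_prop
  · simp only [ringProj, Fin.cons_succ]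
    fun_prop

theorem contDiffAt_eucCons₂ {E : Type*} [NormedAddCommGroup E] [NormedSpace ℝ E] {f g : E → ℝ}
    {z : E → Fin k → ℝ} {x : E} {r : ℕ∞} (hf : ContDiffAt ℝ r f x) (hg : ContDiffAt ℝ r g x)
    (hz : ∀ i, ContDiffAt ℝ r (fun x => z x i) x) :
    ContDiffAt ℝ r (fun x => eucCons₂ (f x) (g x) (z x)) x := by
  rw [contDiffAt_euclidean]
  intro i
  refine Fin.cases ?_ (fun j => Fin.cases ?_ (fun j => ?_) j) i
  · exact hf
  · exact hg
  · exact hz j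

theorem ringRoot_arg_pos {z : Euc (k + 1) × ℝ}
    (hz : z ∈ Metric.closedBall (0 : Euc (k + 1)) 1 ×ˢ Set.Icc (-(9 / 16 : ℝ)) (9 / 16)) :
    0 < 1 / 2 + z.1 0 / 16 - z.2 ^ 2 := by
  have h1 : ‖z.1‖ ≤ 1 := by simpa using hz.1
  have h2 := norm_sq_succ z.1
  have h3 : 0 ≤ ∑ i : Fin k, z.1 i.succ ^ 2 := Finset.sum_nonneg fun i _ => sq_nonneg _
  have h4 : z.1 0 ^ 2 ≤ 1 := by nlinarith [norm_nonneg z.1]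
  have h5 : z.2 ^ 2 ≤ (9 / 16) ^ 2 := sq_le_sq' hz.2.1 hz.2.2
  have h6 : -1 ≤ z.1 0 := by nlinarith
  linarith

theorem contDiffAt_ringRoot {z : Euc (k + 1) × ℝ}
    (hz : z ∈ Metric.closedBall (0 : Euc (k + 1)) 1 ×ˢ Set.Icc (-(9 / 16 : ℝ)) (9 / 16)) :
    ContDiffAt ℝ ∞ ringRoot z :=
  ContDiffAt.sqrt (by fun_prop) (ringRoot_arg_pos hz).ne'

theorem continuous_ringSect : Continuous (ringSect k) := by
  have h : Continuous (ringRoot (k := k)) := Real.continuous_sqrt.comp (by fun_prop)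
  refine (PiLp.continuous_toLp 2 _).comp (continuous_pi fun i => ?_)
  refine Fin.cases ?_ (fun j => Fin.cases ?_ (fun j => ?_) j) i
  · exact h
  · exact continuous_snd
  · simp only [Fin.cons_succ]
    fun_prop

theorem contDiffAt_ringSect {z : Euc (k + 1) × ℝ}
    (hz : z ∈ Metric.closedBall (0 : Euc (k + 1)) 1 ×ˢ Set.Icc (-(9 / 16 : ℝ)) (9 / 16)) :
    ContDiffAt ℝ ∞ (ringSect k) z :=
  contDiffAt_eucCons₂ (contDiffAt_ringRoot hz) (by fun_prop) fun i => by fun_prop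

theorem ringProj_eucCons₂ (a b : ℝ) (z : Fin k → ℝ) : ringProj k (eucCons₂ a b z)
    = WithLp.toLp 2 (Fin.cons (16 * (a ^ 2 + b ^ 2 - 1 / 2))
      (fun i : Fin k => 16 * z i) : Fin (k + 1) → ℝ) := rfl

theorem ringProj_ringSect {z : Euc (k + 1) × ℝ}
    (hz : z ∈ Metric.closedBall (0 : Euc (k + 1)) 1 ×ˢ Set.Icc (-(9 / 16 : ℝ)) (9 / 16)) :
    ringProj k (ringSect k z) = z.1 := by
  rw [ringSect, ringProj_eucCons₂, ringRoot, Real.sq_sqrt (ringRoot_arg_pos hz).le]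
  ext i
  refine Fin.cases ?_ (fun j => ?_) i
  · simp only [Fin.cons_zero]; ring
  · simp only [Fin.cons_succ]; ring

theorem norm_ringSect_lt {z : Euc (k + 1) × ℝ}
    (hz : z ∈ Metric.closedBall (0 : Euc (k + 1)) 1 ×ˢ Set.Icc (-(9 / 16 : ℝ)) (9 / 16)) :
    ‖ringSect k z‖ < 1 := by
  have h1 : ‖z.1‖ ≤ 1 := by simpa using hz.1
  have h2 := norm_sq_succ z.1
  have h3 : 0 ≤ ∑ i : Fin k, z.1 i.succ ^ 2 := Finset.sum_nonneg fun i _ => sq_nonneg _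
  have h4 := norm_sq_eucCons₂ (ringRoot z) z.2 fun i => z.1 i.succ / 16
  rw [ringRoot, Real.sq_sqrt (ringRoot_arg_pos hz).le] at h4
  simp_rw [div_pow] at h4
  rw [← Finset.sum_div] at h4
  have h5 : z.1 0 ≤ 1 := by nlinarith [norm_nonneg z.1]
  have h6 : ∑ i : Fin k, z.1 i.succ ^ 2 ≤ 1 := by nlinarith [norm_nonneg z.1, sq_nonneg (z.1 0)]
  change ‖ringSect k z‖ ^ 2 = _ at h4
  nlinarith [norm_nonneg (ringSect k z)]

theorem ringProj_preimage_subset :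
    ringProj k ⁻¹' Metric.closedBall 0 1 ⊆ Metric.ball 0 1 := by
  intro y hy
  have h1 : ‖ringProj k y‖ ≤ 1 := by simpa using hy
  rw [mem_ball_zero_iff]
  have h2 := norm_sq_ringProj y
  have h3 : ‖y‖ ^ 2 = y 0 ^ 2 + y 1 ^ 2 + ∑ i : Fin k, y i.succ.succ ^ 2 := by
    rw [norm_sq_succ, Fin.sum_univ_succ]; exact (add_assoc _ _ _).symm
  simp_rw [mul_pow] at h2
  rw [← Finset.mul_sum] at h2
  have h4 : 0 ≤ ∑ i : Fin k, y i.succ.succ ^ 2 := Finset.sum_nonneg fun i _ => sq_nonneg _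
  have h5 : ‖ringProj k y‖ ^ 2 ≤ 1 := by nlinarith [norm_nonneg (ringProj k y)]
  have h6 : y 0 ^ 2 + y 1 ^ 2 - 1 / 2 ≤ 1 / 16 := by nlinarith
  nlinarith [norm_nonneg y, sq_nonneg (y 0 ^ 2 + y 1 ^ 2 - 1 / 2)]

/-- The four local trivialisations of `ringProj`; the Boolean parameters choose which of the first
two coordinates is the dependent one, and its sign. -/
noncomputable def ringCover (k : ℕ) (i : Bool × Bool) (z : Euc (k + 1) × ℝ) : Euc (k + 2) :=
  if i.1 then eucCons₂ ((if i.2 then 1 else -1) * ringRoot z) z.2 fun j => z.1 j.succ / 16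
  else eucCons₂ z.2 ((if i.2 then 1 else -1) * ringRoot z) fun j => z.1 j.succ / 16

theorem contDiffAt_ringCover (i : Bool × Bool) {z : Euc (k + 1) × ℝ}
    (hz : z ∈ Metric.closedBall (0 : Euc (k + 1)) 1 ×ˢ Set.Icc (-(9 / 16 : ℝ)) (9 / 16)) :
    ContDiffAt ℝ ∞ (ringCover k i) z := by
  have h1 : ContDiffAt ℝ ∞ (fun z => (if i.2 then (1 : ℝ) else -1) * ringRoot z) z :=
    contDiffAt_const.mul (contDiffAt_ringRoot hz)
  unfold ringCover
  by_cases hi : i.1 = true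
  · simp only [hi, if_true]
    exact contDiffAt_eucCons₂ h1 (by fun_prop) fun i => by fun_prop
  · simp only [hi]
    exact contDiffAt_eucCons₂ (by fun_prop) h1 fun i => by fun_prop

theorem eucCons₂_eta (y : Euc (k + 2)) : eucCons₂ (y 0) (y 1) (fun i => y i.succ.succ) = y := by
  ext i
  refine Fin.cases rfl (fun j => Fin.cases rfl (fun j => rfl) j) i

theorem exists_sign_mul_sqrt (a : ℝ) : ∃ b : Bool, (if b then (1 : ℝ) else -1) * √(a ^ 2) = a := by
  rw [Real.sqrt_sq_eq_abs]
  rcases le_total 0 a with h | h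
  · exact ⟨true, by simp [abs_of_nonneg h]⟩
  · exact ⟨false, by simp [abs_of_nonpos h]⟩

theorem exists_ringCover_eq (y : Euc (k + 2)) (hy : ringProj k y ∈ Metric.ball 0 1) :
    ∃ i, ∃ t ∈ Set.Icc (-(9 / 16 : ℝ)) (9 / 16), ringCover k i (ringProj k y, t) = y := by
  have h1 : ‖ringProj k y‖ < 1 := by simpa using hy
  have h2 := norm_sq_succ (ringProj k y)
  have h3 : 0 ≤ ∑ i : Fin k, ringProj k y i.succ ^ 2 := Finset.sum_nonneg fun i _ => sq_nonneg _
  have h4 : ringProj k y 0 = 16 * (y 0 ^ 2 + y 1 ^ 2 - 1 / 2) := rfl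
  have h5 : ringProj k y 0 ≤ 1 := by nlinarith [norm_nonneg (ringProj k y)]
  have hz : (fun j : Fin k => ringProj k y j.succ / 16) = fun j => y j.succ.succ := by
    ext j
    change 16 * y j.succ.succ / 16 = _
    ring
  rcases le_total (y 1 ^ 2) (y 0 ^ 2) with h | h
  · obtain ⟨b, hb⟩ := exists_sign_mul_sqrt (y 0)
    have hr : ringRoot (ringProj k y, y 1) = √(y 0 ^ 2) := by
      rw [ringRoot, h4]; congr 1; ring
    refine ⟨(true, b), y 1, abs_le.1 (abs_le_of_sq_le_sq (by linarith) (by norm_num)), ?_⟩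
    simp only [ringCover, if_true]
    rw [hr, hb, hz, eucCons₂_eta]
  · obtain ⟨b, hb⟩ := exists_sign_mul_sqrt (y 1)
    have hr : ringRoot (ringProj k y, y 0) = √(y 1 ^ 2) := by
      rw [ringRoot, h4]; congr 1; ring
    refine ⟨(false, b), y 0, abs_le.1 (abs_le_of_sq_le_sq (by linarith) (by norm_num)), ?_⟩
    simp only [ringCover]
    rw [hr, hb, hz]
    exact eucCons₂_eta y

theorem exists_isBallFibration (k : ℕ) :
    ∃ c₁ c₂ : NNReal, IsBallFibration (ringProj k) (ringSect k) (9 / 16) c₁ c₂ := by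
  have hsub : Metric.closedBall (0 : Euc (k + 1)) 1 ×ˢ Set.Icc (0 : ℝ) (9 / 16)
      ⊆ Metric.closedBall (0 : Euc (k + 1)) 1 ×ˢ Set.Icc (-(9 / 16 : ℝ)) (9 / 16) :=
    Set.prod_mono subset_rfl (Set.Icc_subset_Icc_left (by norm_num))
  have hb : ∀ z ∈ Metric.closedBall (0 : Euc (k + 1)) 1 ×ˢ Set.Icc (0 : ℝ) (9 / 16),
      ringSect k z ∈ Metric.ball 0 1 := fun z hz => by
    rw [mem_ball_zero_iff]; exact norm_ringSect_lt (hsub hz)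
  obtain ⟨c₁, h₁⟩ := exists_map_le_of_cover rfl (contDiff_ringProj (k := k)).continuous
    (fun i z hz => (contDiffAt_ringCover i hz).of_le (by simp)) exists_ringCover_eq
  obtain ⟨c₂, h₂⟩ := exists_map_le_of_leftInverse (Θ := fun y : Euc (k + 2) => (ringProj k y, y 1))
    rfl continuous_ringSect hb
    (((contDiff_ringProj (k := k)).of_le (by simp)).prodMk (by fun_prop))
    (fun z hz => Prod.ext (ringProj_ringSect (hsub hz)) rfl)
  exact ⟨c₁, c₂, by norm_num, contDiff_ringProj, ringProj_preimage_subset, h₁,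
    continuous_ringSect, fun z hz => contDiffAt_ringSect (hsub hz), hb,
    fun z hz => ringProj_ringSect (hsub hz), h₂⟩

end Rotation

theorem corollary5p2 {k ℓ : ℕ} {N : Type*} [TopologicalSpace N] [ChartedSpace (Euc k) N]
    [IsManifold (𝓡 k) ∞ N] [CompactSpace N]
    (ι : N → Euc ℓ) (hι : Manifold.IsSmoothEmbedding (𝓡 k) 𝓘(ℝ, Euc ℓ) ∞ ι)
    (p : ℝ≥0∞) [Fact (1 ≤ p)] (hp₁ : 1 < p) (hp : p < ⊤)
    (m₀ : ℕ) (hm₀ : 1 ≤ m₀)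
    (hu : ∃ u ∈ W1pConst m₀ p (Set.range ι), ¬ IsWeakLimitOfSmooth (Set.range ι) u)
    (m : ℕ) (hm : m₀ ≤ m) :
    ∃ v ∈ W1pConst m p (Set.range ι), ¬ IsWeakLimitOfSmooth (Set.range ι) v := by
  induction m, hm using Nat.le_induction with
  | base => exact hu
  | succ m hm ih =>
    obtain ⟨j, rfl⟩ : ∃ j, m = j + 1 := ⟨m - 1, by omega⟩
    obtain ⟨c₁, c₂, H⟩ := exists_isBallFibration j
    exact H.exists_not_isWeakLimitOfSmooth hp₁ hp.ne ih
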